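/- Let $\mathbb{RP}^2$ be the real projective plane. An *$n$-configuration* is a set of $n$ distinct points of $\mathbb{RP}^2$; the space of $n$-configurations carries the quotient topology from the space of ordered $n$-tuples of distinct points. A configuration is *simple* if no three of its points are collinear, and *typical* if it is simple and no six of its points lie on a conic. A *Q-deformation class* is an equivalence class of typical $n$-configurations under the relation of being joined by a continuous path of typical $n$-configurations. The *adjacency graph* $\Gamma_{\mathcal P}$ of a simple configuration $\mathcal P$ has the points of $\mathcal P$ as its vertices; two distinct points $p,q$ are adjacent if at least one of the two segments with endpoints $p,q$ on the projective line $pq$ is not crossed by any line through two points of $\mathcal P\smallsetminus\{p,q\}$. The *derivative code* of a simple $7$-configuration $\mathcal P$ is $(\sigma_1,\sigma_2,\sigma_3,\sigma_6)$, where $\sigma_k$ is the number of points $p\in\mathcal P$ such that $\Gamma_{\mathcal P\smallsetminus\{p\}}$ has exactly $k$ connected components. Let $LC^7_\sigma$ be the set of simple $7$-configurations with derivative code $\sigma$, and let $QC^7_\sigma$ be the set of typical configurations in $LC^7_\sigma$. **Proposition 5.1.** The space $QC^7_{(1,6,0,0)}$ is (non-empty and) connected, and the class $LC^7_{(1,6,0,0)}$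 contains exactly one Q-deformation class. -/

import Mathlib

open scoped LinearAlgebra.Projectivization

namespace PlaneConfig

/-- The real projective plane. -/
abbrev RP2 : Type := ℙ ℝ (Fin 3 → ℝ)

/-- The quotient topology of the projective plane, coming from the nonzero vectors of `ℝ³`. -/
noncomputable instance instTopologicalSpaceRP2 : TopologicalSpace RP2 :=
  TopologicalSpace.coinduced
    (fun v : {v : Fin 3 → ℝ // v ≠ 0} => Projectivization.mk ℝ v.1 v.2) inferInstance

/-- An (unordered) `n`-configuration: a set of exactly `n` points of the projective plane. -/
@[ext]
structure Configuration (n : ℕ) where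
  points : Set RP2
  encard_points : points.encard = n

/-- The configuration underlying an ordered tuple of `n` distinct points. -/
def Configuration.ofTuple {n : ℕ} (f : {f : Fin n → RP2 // Function.Injective f}) :
    Configuration n where
  points := Set.range f.1
  encard_points := by
    rw [← Set.image_univ, f.2.encard_image, Set.encard_univ]
    simp

/-- The topology of the unordered configuration space: the quotient topology coming from the
space of ordered tuples of distinct points, which is a subspace of the product `(RP2)ⁿ`. -/
noncomputable instance instTopologicalSpaceConfiguration (n : ℕ) : TopologicalSpace (Configuration n) :=
  TopologicalSpace.coinduced (Configuration.ofTuple (n := n)) inferInstance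

/-- All points of `S` lie on one conic, i.e. on the zero locus of a nonzero ternary quadratic
form. -/
def IsCoconic (S : Set RP2) : Prop :=
  ∃ Q : QuadraticForm ℝ (Fin 3 → ℝ), Q ≠ 0 ∧ ∀ x ∈ S, Q x.rep = 0

/-- `S` contains no collinear triple of points. -/
def IsSimple (S : Set RP2) : Prop :=
  ∀ T ⊆ S, T.encard = 3 → ¬ Projectivization.IsCollinear T

/-- `S` contains no collinear triple and no coconic sextuple of points. -/
def IsTypical (S : Set RP2) : Prop :=
  IsSimple S ∧ ∀ T ⊆ S, T.encard = 6 → ¬ IsCoconic T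

/-- The image in the projective plane of the straight segment between two vectors. If `u` and `v`
represent distinct points `p` and `q`, then the two segments with endpoints `p` and `q` on the
projective line through `p` and `q` are `projSegment u v` and `projSegment u (-v)`. -/
def projSegment (u v : Fin 3 → ℝ) : Set RP2 :=
  {x | ∃ w ∈ segment ℝ u v, ∃ hw : w ≠ 0, Projectivization.mk ℝ w hw = x}

/-- One of the two projective segments joining `p` and `q` is not crossed by any of the lines
through two distinct points of `S \ {p, q}`. -/
def HasUncrossedSegment (S : Set RP2) (p q : RP2) : Prop :=
  ∃ (u v : Fin 3 → ℝ) (hu : u ≠ 0) (hv : v ≠ 0),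
    Projectivization.mk ℝ u hu = p ∧ Projectivization.mk ℝ v hv = q ∧
    ∀ r ∈ S \ {p, q}, ∀ s ∈ S \ {p, q}, r ≠ s →
      ∀ x ∈ projSegment u v, ¬ Projectivization.IsCollinear {x, r, s}

/-- The adjacency graph of a configuration: its vertices are the points of the configuration, and
two of them are adjacent if they are joined by a segment that is not crossed by any line through
two of the remaining points. -/
def adjacencyGraph (S : Set RP2) : SimpleGraph S where
  Adj p q := p ≠ q ∧ HasUncrossedSegment S p q
  symm := ⟨by
    rintro p q ⟨hne, u, v, hu, hv, hp, hq, h⟩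
    refine ⟨hne.symm, v, u, hv, hu, hq, hp, ?_⟩
    rw [Set.pair_comm, projSegment, segment_symm]
    exact h⟩
  loopless := ⟨fun _ h => h.1 rfl⟩

/-- The number of connected components of the adjacency graph. -/
noncomputable def componentCount (S : Set RP2) : ℕ :=
  Nat.card (adjacencyGraph S).ConnectedComponent

/-- The number of points `p` of `S` such that the adjacency graph of `S \ {p}` has exactly `k`
connected components. -/
noncomputable def labelCount (S : Set RP2) (k : ℕ) : ℕ :=
  {p ∈ S | componentCount (S \ {p}) = k}.ncard

/-- The derivative code `(σ₁, σ₂, σ₃, σ₆)`. -/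
noncomputable def derivativeCode (S : Set RP2) : ℕ × ℕ × ℕ × ℕ :=
  (labelCount S 1, labelCount S 2, labelCount S 3, labelCount S 6)

/-- The class `LC⁷_σ` of simple `7`-configurations with derivative code `σ`. -/
def LC7 (σ : ℕ × ℕ × ℕ × ℕ) : Set (Configuration 7) :=
  {P | IsSimple P.points ∧ derivativeCode P.points = σ}

/-- The space of typical `n`-configurations. -/
def typicalConfigurations (n : ℕ) : Set (Configuration n) :=
  {P | IsTypical P.points}

/-- The space `QC⁷_σ` of typical `7`-configurations in `LC⁷_σ`. -/
def QC7 (σ : ℕ × ℕ × ℕ × ℕ) : Set (Configuration 7) :=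
  LC7 σ ∩ typicalConfigurations 7

/-- A Q-deformation class of `n`-configurations: a set consisting of all the typical
`n`-configurations that can be joined to a given typical one by a path of typical
configurations. -/
def IsQDeformationClass {n : ℕ} (C : Set (Configuration n)) : Prop :=
  ∃ P ∈ typicalConfigurations n, C = pathComponentIn (typicalConfigurations n) P

end PlaneConfig

/-!
A simple configuration of seven points with derivative code `(1, 6, 0, 0)` consists of a hexagon and
a point `p`. The hexagon splits into three pairs `A, A'`, `B, B'`, `C, C'` such that, in the
coordinates in which the lines `AA'`, `BB'`, `CC'` are the coordinate lines and `p = (1 : 1 : 1)`,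
the points are
`A = (0 : 1 : -a)`, `A' = (0 : 1 : -a')`, `B = (-b : 0 : 1)`, `B' = (-b' : 0 : 1)`,
`C = (1 : -c : 0)`, `C' = (1 : -c' : 0)`
with positive parameters (`normalForm`). The bracket `[A B C]` equals `1 - a b c`, and the brackets
`[A B p]` are positive for all values of the parameters, so that the bracket signs of the
configuration are described by inequalities between monomials. For the code `(1, 6, 0, 0)` they say
that `a` times any of `b`, `b'` times any of `c`, `c'` is less than one, and that `a'` times any of
them is more than one. In the logarithms of the parameters these conditions define a convex cone
(`logCone`).

A conic through six points including `p` does not exist: if it passes through the five other points,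
then all its coefficients have the same sign, so it misses `p` (`coeff_eq_zero`). By Carnot's
theorem, the points of the hexagon are coconic if and only if `a a' b b' c c' = 1`, which is a
hyperplane in the logarithmic parameters (`typical_normalForm`, `prod_ne_one_of_typical`). It cuts
the cone into two convex halves, and exchanging the last two coordinates exchanges the halves
(`qEquivalent_expForm_neg`). As the group of projective transformations is path connected
(`Typical.qEquivalent_mulVec`), all typical normal forms are joined by paths of typical
configurations.

It remains to recognize the normal form from the code. Adjacency of two points `i`, `j` means that
the products `[i r s] [j r s]` have a constant sign (`hasUncrossedSegment_pt_iff`). No point is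
adjacent to three others, so a connected adjacency graph on six points has a Hamiltonian path, along
which the representing vectors can be given signs that make all brackets positive
(`exists_hexagon`). Around each vertex of this hexagon the position of the seventh point is governed
by the Grassmann–Plücker relation, which leaves 74 sign patterns, and a finite search shows that
those with the right code are the normal forms (`searchB_hexagonSigns`, `exists_normalSigns`).

Conversely, the code depends only on the bracket signs, so every class `LC7 σ` is open
(`isOpen_LC7`), and a path of typical configurations cannot leave it (`LC7_of_joinedIn`).
-/

namespace PlaneConfig

/-! ### Brackets -/

/-- The bracket `[u v w]`: the determinant of the matrix with rows `u`, `v`, `w`. -/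
def bracket (u v w : Fin 3 → ℝ) : ℝ :=
  u 0 * (v 1 * w 2 - v 2 * w 1) - u 1 * (v 0 * w 2 - v 2 * w 0) + u 2 * (v 0 * w 1 - v 1 * w 0)

lemma bracket_eq_det (u v w : Fin 3 → ℝ) : bracket u v w = (Matrix.of ![u, v, w]).det := by
  simp [bracket, Matrix.det_fin_three]; ring

lemma bracket_rotate (u v w : Fin 3 → ℝ) : bracket v w u = bracket u v w := by
  simp only [bracket]; ring

lemma bracket_swap_left (u v w : Fin 3 → ℝ) : bracket v u w = -bracket u v w := by
  simp only [bracket]; ring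

lemma bracket_swap_right (u v w : Fin 3 → ℝ) : bracket u w v = -bracket u v w := by
  simp only [bracket]; ring

@[simp] lemma bracket_self_left (u v : Fin 3 → ℝ) : bracket u u v = 0 := by
  simp only [bracket]; ring

@[simp] lemma bracket_self_right (u v : Fin 3 → ℝ) : bracket u v v = 0 := by
  simp only [bracket]; ring

@[simp] lemma bracket_self_outer (u v : Fin 3 → ℝ) : bracket u v u = 0 := by
  simp only [bracket]; ring

lemma bracket_smul (a b c : ℝ) (u v w : Fin 3 → ℝ) :
    bracket (a • u) (b • v) (c • w) = a * b * c * bracket u v w := by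
  simp only [bracket, Pi.smul_apply, smul_eq_mul]; ring

lemma bracket_smul_add_smul (a b : ℝ) (u u' v w : Fin 3 → ℝ) :
    bracket (a • u + b • u') v w = a * bracket u v w + b * bracket u' v w := by
  simp only [bracket, Pi.smul_apply, Pi.add_apply, smul_eq_mul]; ring

lemma bracket_mulVec (M : Matrix (Fin 3) (Fin 3) ℝ) (u v w : Fin 3 → ℝ) :
    bracket (M.mulVec u) (M.mulVec v) (M.mulVec w) = M.det * bracket u v w := by
  simp only [bracket, Matrix.mulVec, dotProduct, Fin.sum_univ_three, Matrix.det_fin_three]; ring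

/-- The three-term Grassmann–Plücker relation. -/
lemma bracket_plucker (x a b c d : Fin 3 → ℝ) :
    bracket x a b * bracket x c d - bracket x a c * bracket x b d
      + bracket x a d * bracket x b c = 0 := by
  simp only [bracket]; ring

lemma bracket_eq_zero_iff (u v w : Fin 3 → ℝ) :
    bracket u v w = 0 ↔ ¬ LinearIndependent ℝ ![u, v, w] := by
  rw [bracket_eq_det, ← not_iff_not, not_not, ← ne_eq, ← isUnit_iff_ne_zero, ← Matrix.isUnit_iff_isUnit_det,
    ← Matrix.linearIndependent_rows_iff_isUnit]
  rfl

lemma isCollinear_mk_iff {u v w : Fin 3 → ℝ} (hu : u ≠ 0) (hv : v ≠ 0) (hw : w ≠ 0) :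
    Projectivization.IsCollinear
      {Projectivization.mk ℝ u hu, Projectivization.mk ℝ v hv, Projectivization.mk ℝ w hw} ↔
      bracket u v w = 0 := by
  rw [bracket_eq_zero_iff]
  constructor
  · rintro ⟨M, -, hM, hsub⟩ hli
    have hmem : ∀ i, ![u, v, w] i ∈ M.submodule := by
      intro i
      fin_cases i
      · exact (Projectivization.Subspace.mem_submodule_iff M hu).2 (hsub (by simp))
      · exact (Projectivization.Subspace.mem_submodule_iff M hv).2 (hsub (by simp))
      · exact (Projectivization.Subspace.mem_submodule_iff M hw).2 (hsub (by simp))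
    have hli' : LinearIndependent ℝ (fun i => (⟨![u, v, w] i, hmem i⟩ : M.submodule)) :=
      LinearIndependent.of_comp M.submodule.subtype hli
    have := hli'.fintype_card_le_finrank
    simp at this
    omega
  · intro hli
    refine ⟨(Submodule.span ℝ (Set.range ![u, v, w])).projectivization, inferInstance, ?_, ?_⟩
    · rw [Projectivization.Subspace.submodule.apply_symm_apply]
      rw [linearIndependent_iff_card_le_finrank_span] at hli
      simp [Set.finrank] at hli ⊢
      omega
    · rintro x hx
      simp only [Set.mem_insert_iff, Set.mem_singleton_iff] at hx
      rcases hx with rfl | rfl | rfl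
      · exact (Submodule.mk_mem_projectivization_iff _ _).2 (Submodule.subset_span ⟨0, rfl⟩)
      · exact (Submodule.mk_mem_projectivization_iff _ _).2 (Submodule.subset_span ⟨1, rfl⟩)
      · exact (Submodule.mk_mem_projectivization_iff _ _).2 (Submodule.subset_span ⟨2, rfl⟩)

/-! ### Vector families representing simple configurations -/

/-- The points of the projective plane represented by a family of nonzero vectors. -/
noncomputable def pt {ι : Type*} (v : ι → Fin 3 → ℝ) (h : ∀ i, v i ≠ 0) (i : ι) : RP2 :=
  Projectivization.mk ℝ (v i) (h i)

/-- A family of vectors is general if any three of its members are linearly independent. -/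
def General {ι : Type*} (v : ι → Fin 3 → ℝ) : Prop :=
  ∀ i j k, i ≠ j → j ≠ k → i ≠ k → bracket (v i) (v j) (v k) ≠ 0

section

variable {ι : Type*} {v : ι → Fin 3 → ℝ}

lemma General.comp {κ : Type*} (hv : General v) {f : κ → ι} (hf : Function.Injective f) :
    General (v ∘ f) := fun _ _ _ hij hjk hik =>
  hv _ _ _ (hf.ne hij) (hf.ne hjk) (hf.ne hik)

lemma General.smul (hv : General v) {ε : ι → ℝ} (hε : ∀ i, ε i ≠ 0) :
    General (fun i => ε i • v i) := fun i j k hij hjk hik => by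
  rw [bracket_smul]
  exact mul_ne_zero (mul_ne_zero (mul_ne_zero (hε i) (hε j)) (hε k)) (hv i j k hij hjk hik)

lemma General.ne_zero [Fintype ι] (hv : General v) (hι : 3 ≤ Fintype.card ι) (i : ι) :
    v i ≠ 0 := by
  classical
  obtain ⟨j, hj⟩ : ∃ j, j ∉ ({i} : Finset ι) := by
    by_contra! h
    have := Finset.card_le_card (fun x _ => h x : Finset.univ ⊆ ({i} : Finset ι))
    simp at this
    omega
  obtain ⟨k, hk⟩ : ∃ k, k ∉ ({i, j} : Finset ι) := by
    by_contra! h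
    have := Finset.card_le_card (fun x _ => h x : Finset.univ ⊆ ({i, j} : Finset ι))
    have h2 := Finset.card_le_two (a := i) (b := j)
    simp only [Finset.card_univ] at this
    omega
  simp only [Finset.mem_singleton, Finset.mem_insert, not_or] at hj hk
  intro h0
  refine hv i j k (Ne.symm hj) (Ne.symm hk.2) (Ne.symm hk.1) ?_
  simp [bracket, h0]

lemma General.pt_injective [Fintype ι] (hv : General v) (hι : 3 ≤ Fintype.card ι)
    (h0 : ∀ i, v i ≠ 0) : Function.Injective (pt v h0) := by
  classical
  intro i j hij
  by_contra hne
  obtain ⟨k, hk⟩ : ∃ k, k ∉ ({i, j} : Finset ι) := by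
    by_contra! h
    have := Finset.card_le_card (fun x _ => h x : Finset.univ ⊆ ({i, j} : Finset ι))
    have h2 := Finset.card_le_two (a := i) (b := j)
    simp only [Finset.card_univ] at this
    omega
  simp only [Finset.mem_singleton, Finset.mem_insert, not_or] at hk
  obtain ⟨a, ha⟩ := (Projectivization.mk_eq_mk_iff' ℝ _ _ (h0 i) (h0 j)).1 hij
  refine hv i j k hne (Ne.symm hk.2) (Ne.symm hk.1) ?_
  have := bracket_smul a 1 1 (v j) (v j) (v k)
  rw [one_smul, one_smul, ha] at this
  simpa using this

lemma isSimple_range_pt_iff (h0 : ∀ i, v i ≠ 0) (hinj : Function.Injective (pt v h0)) :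
    IsSimple (Set.range (pt v h0)) ↔ General v := by
  constructor
  · intro h i j k hij hjk hik hb
    refine h {pt v h0 i, pt v h0 j, pt v h0 k} ?_ ?_ ((isCollinear_mk_iff _ _ _).2 hb)
    · rintro x (rfl | rfl | rfl) <;> exact ⟨_, rfl⟩
    · rw [Set.encard_eq_three]
      exact ⟨_, _, _, hinj.ne hij, hinj.ne hik, hinj.ne hjk, rfl⟩
  · rintro h T hT hcard hcol
    obtain ⟨x, y, z, hxy, hxz, hyz, rfl⟩ := Set.encard_eq_three.1 hcard
    obtain ⟨i, rfl⟩ := hT (show x ∈ _ by simp)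
    obtain ⟨j, rfl⟩ := hT (show y ∈ _ by simp)
    obtain ⟨k, rfl⟩ := hT (show z ∈ _ by simp)
    refine h i j k (fun e => hxy (by rw [e])) (fun e => hyz (by rw [e]))
      (fun e => hxz (by rw [e])) ((isCollinear_mk_iff _ _ _).1 hcol)

/-! ### The adjacency graph in terms of brackets -/

/-- The adjacency graph of a configuration, read off the brackets of a representing family `v`:
`i` and `j` are adjacent if the products `[i r s] [j r s]` have a constant sign. -/
def bracketGraph (v : ι → Fin 3 → ℝ) : SimpleGraph ι where
  Adj i j := i ≠ j ∧
    ((∀ r s, r ≠ s → r ≠ i → r ≠ j → s ≠ i → s ≠ j →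
        0 < bracket (v i) (v r) (v s) * bracket (v j) (v r) (v s)) ∨
      ∀ r s, r ≠ s → r ≠ i → r ≠ j → s ≠ i → s ≠ j →
        bracket (v i) (v r) (v s) * bracket (v j) (v r) (v s) < 0)
  symm := ⟨by
    rintro i j ⟨hij, h | h⟩
    · exact ⟨hij.symm, .inl fun r s h1 h2 h3 h4 h5 => by
        rw [mul_comm]; exact h r s h1 h3 h2 h5 h4⟩
    · exact ⟨hij.symm, .inr fun r s h1 h2 h3 h4 h5 => by
        rw [mul_comm]; exact h r s h1 h3 h2 h5 h4⟩⟩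
  loopless := ⟨fun _ h => h.1 rfl⟩

lemma bracket_smul_left (a : ℝ) (u v w : Fin 3 → ℝ) :
    bracket (a • u) v w = a * bracket u v w := by
  simp only [bracket, Pi.smul_apply, smul_eq_mul]; ring

/-- A segment from `u` to `v` that misses the line `r s` stays on one side of it. -/
lemma forall_mem_projSegment_iff {u v r s : Fin 3 → ℝ} (hr : r ≠ 0) (hs : s ≠ 0)
    (huv : ∀ w ∈ segment ℝ u v, w ≠ 0) :
    (∀ x ∈ projSegment u v, ¬ Projectivization.IsCollinear
        {x, Projectivization.mk ℝ r hr, Projectivization.mk ℝ s hs}) ↔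
      0 < bracket u r s * bracket v r s := by
  have key : (∀ x ∈ projSegment u v, ¬ Projectivization.IsCollinear
        {x, Projectivization.mk ℝ r hr, Projectivization.mk ℝ s hs}) ↔
      ∀ w ∈ segment ℝ u v, bracket w r s ≠ 0 := by
    constructor
    · intro h w hw hb
      exact h _ ⟨w, hw, huv w hw, rfl⟩ ((isCollinear_mk_iff _ _ _).2 hb)
    · rintro h x ⟨w, hw, hw0, rfl⟩ hc
      exact h w hw ((isCollinear_mk_iff _ _ _).1 hc)
  rw [key]
  constructor
  · intro h
    by_contra! hle
    have hu := h u (left_mem_segment ℝ u v)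
    have hv := h v (right_mem_segment ℝ u v)
    set a := bracket u r s
    set b := bracket v r s
    have hlt : a * b < 0 := lt_of_le_of_ne hle (mul_ne_zero hu hv)
    -- the point of the segment on the line has weights proportional to `|b|` and `|a|`
    have hab : |b| + |a| ≠ 0 := by positivity
    refine h ((|b| / (|b| + |a|)) • u + (|a| / (|b| + |a|)) • v)
      ⟨_, _, by positivity, by positivity, by field_simp, rfl⟩ ?_
    rw [bracket_smul_add_smul]
    change |b| / (|b| + |a|) * a + |a| / (|b| + |a|) * b = 0
    have : |b| * a + |a| * b = 0 := by
      rcases mul_neg_iff.1 hlt with ⟨h1, h2⟩ | ⟨h1, h2⟩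
      · rw [abs_of_pos h1, abs_of_neg h2]; ring
      · rw [abs_of_neg h1, abs_of_pos h2]; ring
    field_simp
    linarith
  · rintro h w ⟨s', t, hs', ht, hst, rfl⟩
    rw [bracket_smul_add_smul]
    rcases pos_and_pos_or_neg_and_neg_of_mul_pos h with ⟨h1, h2⟩ | ⟨h1, h2⟩
    · rcases hs'.eq_or_lt with rfl | hs''
      · have : t = 1 := by linarith
        subst this; nlinarith
      · have := mul_pos hs'' h1
        have := mul_nonneg ht h2.le
        linarith
    · rcases hs'.eq_or_lt with rfl | hs''
      · have : t = 1 := by linarith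
        subst this; nlinarith
      · have := mul_neg_of_pos_of_neg hs'' h1
        have := mul_nonpos_of_nonneg_of_nonpos ht h2.le
        linarith

lemma hasUncrossedSegment_pt_iff (h0 : ∀ i, v i ≠ 0)
    (hinj : Function.Injective (pt v h0)) {i j : ι} (hij : i ≠ j) :
    HasUncrossedSegment (Set.range (pt v h0)) (pt v h0 i) (pt v h0 j) ↔
      (bracketGraph v).Adj i j := by
  have hmem : ∀ r, pt v h0 r ∈ Set.range (pt v h0) \ {pt v h0 i, pt v h0 j} ↔ r ≠ i ∧ r ≠ j := by
    intro r
    simp [hinj.eq_iff]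
  have hseg : ∀ a b : ℝ, a ≠ 0 → b ≠ 0 → ∀ w ∈ segment ℝ (a • v i) (b • v j), w ≠ 0 := by
    rintro a b ha hb w ⟨s, t, hs, ht, hst, rfl⟩ hw
    have hpos : s ≠ 0 ∨ t ≠ 0 := by
      by_contra! h
      simp [h.1, h.2] at hst
    apply hij
    apply hinj
    apply (Projectivization.mk_eq_mk_iff' ℝ _ _ _ _).2
    rw [smul_smul, smul_smul] at hw
    have hs0 : s ≠ 0 := by
      rintro rfl
      have : t * b ≠ 0 := mul_ne_zero (by simpa using hpos) hb
      simp only [zero_mul, zero_smul, zero_add, smul_eq_zero] at hw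
      exact hw.elim this (h0 j)
    refine ⟨-((s * a)⁻¹ * (t * b)), ?_⟩
    have hsa : s * a ≠ 0 := mul_ne_zero hs0 ha
    have h1 : (s * a) • v i = -((t * b) • v j) := eq_neg_of_add_eq_zero_left hw
    calc -((s * a)⁻¹ * (t * b)) • v j = (s * a)⁻¹ • (-((t * b) • v j)) := by
          rw [neg_smul, smul_neg, smul_smul]
      _ = v i := by rw [← h1, smul_smul, inv_mul_cancel₀ hsa, one_smul]
  have main : ∀ a b : ℝ, a ≠ 0 → b ≠ 0 →
      ((∀ r ∈ Set.range (pt v h0) \ {pt v h0 i, pt v h0 j},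
        ∀ s ∈ Set.range (pt v h0) \ {pt v h0 i, pt v h0 j}, r ≠ s →
        ∀ x ∈ projSegment (a • v i) (b • v j), ¬ Projectivization.IsCollinear {x, r, s}) ↔
      ∀ r s, r ≠ s → r ≠ i → r ≠ j → s ≠ i → s ≠ j →
        0 < (a * b) * (bracket (v i) (v r) (v s) * bracket (v j) (v r) (v s))) := by
    intro a b ha hb
    have e : ∀ r s, (a * b) * (bracket (v i) (v r) (v s) * bracket (v j) (v r) (v s)) =
        bracket (a • v i) (v r) (v s) * bracket (b • v j) (v r) (v s) := by
      intro r s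
      rw [bracket_smul_left, bracket_smul_left]; ring
    constructor
    · intro h r s hrs hri hrj hsi hsj
      rw [e]
      exact (forall_mem_projSegment_iff (h0 r) (h0 s) (hseg a b ha hb)).1
        (h _ ((hmem r).2 ⟨hri, hrj⟩) _ ((hmem s).2 ⟨hsi, hsj⟩) (hinj.ne hrs))
    · rintro h r hr s hs hrs
      obtain ⟨r, rfl⟩ := hr.1
      obtain ⟨s, rfl⟩ := hs.1
      rw [hmem] at hr hs
      refine (forall_mem_projSegment_iff (h0 r) (h0 s) (hseg a b ha hb)).2 ?_
      rw [← e]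
      exact h r s (fun e => hrs (by rw [e])) hr.1 hr.2 hs.1 hs.2
  constructor
  · rintro ⟨u, w, hu, hw, hui, hwj, h⟩
    obtain ⟨a, rfl⟩ := (Projectivization.mk_eq_mk_iff' ℝ _ _ hu (h0 i)).1 hui
    obtain ⟨b, rfl⟩ := (Projectivization.mk_eq_mk_iff' ℝ _ _ hw (h0 j)).1 hwj
    have ha : a ≠ 0 := by rintro rfl; simp at hu
    have hb : b ≠ 0 := by rintro rfl; simp at hw
    have h' := (main a b ha hb).1 h
    refine ⟨hij, ?_⟩
    rcases lt_or_gt_of_ne (mul_ne_zero ha hb) with hab | hab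
    · refine .inr fun r s h1 h2 h3 h4 h5 => ?_
      by_contra! hc
      have := h' r s h1 h2 h3 h4 h5
      have := mul_nonpos_of_nonpos_of_nonneg hab.le hc
      linarith
    · refine .inl fun r s h1 h2 h3 h4 h5 => ?_
      exact pos_of_mul_pos_right (h' r s h1 h2 h3 h4 h5) hab.le
  · rintro ⟨-, h | h⟩
    · refine ⟨(1 : ℝ) • v i, (1 : ℝ) • v j, by simpa using h0 i, by simpa using h0 j,
        by simp [pt], by simp [pt], (main 1 1 one_ne_zero one_ne_zero).2 ?_⟩
      simpa using h
    · refine ⟨(1 : ℝ) • v i, (-1 : ℝ) • v j, by simpa using h0 i, by simpa using h0 j,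
        by simp [pt], (Projectivization.mk_eq_mk_iff' ℝ _ _ _ _).2 ⟨-1, rfl⟩,
        (main 1 (-1) one_ne_zero (by simp)).2 ?_⟩
      intro r s h1 h2 h3 h4 h5
      have := h r s h1 h2 h3 h4 h5
      linarith

/-- The bracket graph of a family is the adjacency graph of the points it represents. -/
noncomputable def bracketGraphIso (h0 : ∀ i, v i ≠ 0)
    (hinj : Function.Injective (pt v h0)) :
    bracketGraph v ≃g adjacencyGraph (Set.range (pt v h0)) where
  toEquiv := Equiv.ofInjective _ hinj
  map_rel_iff' := by
    intro i j
    by_cases hij : i = j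
    · subst hij; simp
    · rw [← hasUncrossedSegment_pt_iff h0 hinj hij]
      exact ⟨fun h => h.2, fun h => ⟨fun e => hinj.ne hij (congrArg Subtype.val e), h⟩⟩

lemma componentCount_range_pt (h0 : ∀ i, v i ≠ 0)
    (hinj : Function.Injective (pt v h0)) :
    componentCount (Set.range (pt v h0)) = Nat.card (bracketGraph v).ConnectedComponent :=
  (Nat.card_congr (bracketGraphIso h0 hinj).connectedComponentEquiv).symm

end

/-! ### The configuration space -/

/-- The number of components of the adjacency graph of the configuration represented by `v` with
its `m`-th point removed. -/
noncomputable def derivedCount (v : Fin 7 → Fin 3 → ℝ) (m : Fin 7) : ℕ :=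
  Nat.card (bracketGraph (fun i : {i : Fin 7 // i ≠ m} => v i)).ConnectedComponent

/-- The configuration represented by a general family of seven vectors. -/
noncomputable def toConfig (v : {v : Fin 7 → Fin 3 → ℝ // General v}) : Configuration 7 :=
  Configuration.ofTuple ⟨pt v.1 (v.2.ne_zero (by simp)), v.2.pt_injective (by simp) _⟩

lemma toConfig_points (v : {v : Fin 7 → Fin 3 → ℝ // General v}) (h0 : ∀ i, v.1 i ≠ 0) :
    (toConfig v).points = Set.range (pt v.1 h0) := rfl

lemma isSimple_toConfig (v : {v : Fin 7 → Fin 3 → ℝ // General v}) :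
    IsSimple (toConfig v).points :=
  (isSimple_range_pt_iff _ (v.2.pt_injective (by simp) _)).2 v.2

lemma exists_injective_range_eq (P : Configuration 7) :
    ∃ f : Fin 7 → RP2, Function.Injective f ∧ Set.range f = P.points := by
  have hfin : P.points.Finite := Set.finite_of_encard_eq_coe P.encard_points
  have hcard : P.points.ncard = 7 := by
    rw [Set.ncard_def, P.encard_points]; rfl
  have : Finite P.points := hfin
  have e : Fin 7 ≃ P.points := (Finite.equivFinOfCardEq (by
    rw [Nat.card_coe_set_eq, hcard])).symm
  exact ⟨fun i => e i, Subtype.val_injective.comp e.injective, by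
    rw [show (fun i => (e i : RP2)) = Subtype.val ∘ e from rfl, Set.range_comp, e.range_eq_univ]
    simp⟩

lemma exists_toConfig_eq {P : Configuration 7} (hP : IsSimple P.points) :
    ∃ v, toConfig v = P := by
  obtain ⟨f, hf, hfr⟩ := exists_injective_range_eq P
  have hpt : pt (fun i => (f i).rep) (fun i => (f i).rep_nonzero) = f := by
    funext i; exact (f i).mk_rep
  have hg : General (fun i => (f i).rep) := by
    rw [← isSimple_range_pt_iff (fun i => (f i).rep_nonzero) (by rw [hpt]; exact hf), hpt, hfr]
    exact hP
  refine ⟨⟨_, hg⟩, ?_⟩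
  ext1
  rw [toConfig_points _ (fun i => (f i).rep_nonzero), hpt, hfr]

lemma componentCount_toConfig_diff (v : {v : Fin 7 → Fin 3 → ℝ // General v})
    (h0 : ∀ i, v.1 i ≠ 0) (m : Fin 7) :
    componentCount ((toConfig v).points \ {pt v.1 h0 m}) = derivedCount v.1 m := by
  have hinj := v.2.pt_injective (by simp) h0
  have hrange : (toConfig v).points \ {pt v.1 h0 m} =
      Set.range (pt (fun i : {i : Fin 7 // i ≠ m} => v.1 i) fun i => h0 i) := by
    ext x
    rw [toConfig_points v h0]
    constructor
    · rintro ⟨⟨i, rfl⟩, hi⟩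
      exact ⟨⟨i, fun e => hi (by rw [e]; rfl)⟩, rfl⟩
    · rintro ⟨⟨i, hi⟩, rfl⟩
      exact ⟨⟨i, rfl⟩, fun e => hi (hinj e)⟩
  rw [hrange, componentCount_range_pt, derivedCount]
  intro i j hij
  exact Subtype.ext (hinj hij)

lemma labelCount_toConfig (v : {v : Fin 7 → Fin 3 → ℝ // General v}) (k : ℕ) :
    labelCount (toConfig v).points k = {m | derivedCount v.1 m = k}.ncard := by
  have h0 := v.2.ne_zero (by simp)
  have hinj := v.2.pt_injective (by simp) h0
  rw [labelCount, ← Set.ncard_image_of_injective _ hinj]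
  congr 1
  ext x
  constructor
  · rintro ⟨⟨m, rfl⟩, hm⟩
    exact ⟨m, (componentCount_toConfig_diff v h0 m).symm.trans hm, rfl⟩
  · rintro ⟨m, hm, rfl⟩
    exact ⟨⟨m, rfl⟩, (componentCount_toConfig_diff v h0 m).trans hm⟩

/-- Families with the same bracket signs have the same bracket graph. -/
lemma bracketGraph_congr {ι : Type*} {v w : ι → Fin 3 → ℝ}
    (h : ∀ i j k, i ≠ j → j ≠ k → i ≠ k →
      0 < bracket (v i) (v j) (v k) * bracket (w i) (w j) (w k)) :
    bracketGraph v = bracketGraph w := by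
  have aux : ∀ a b c d : ℝ, 0 < a * b → 0 < c * d → ((0 < a * c ↔ 0 < b * d) ∧
      (a * c < 0 ↔ b * d < 0)) := by
    intro a b c d h1 h2
    have h3 : 0 < (a * c) * (b * d) := by nlinarith [mul_pos h1 h2]
    exact ⟨pos_iff_pos_of_mul_pos h3, neg_iff_neg_of_mul_pos h3⟩
  ext i j
  refine and_congr_right fun hij => or_congr ?_ ?_ <;>
    refine forall_congr' fun r => forall_congr' fun s => forall_congr' fun h1 =>
      forall_congr' fun h2 => forall_congr' fun h3 => forall_congr' fun h4 =>
      forall_congr' fun h5 => ?_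
  · exact (aux _ _ _ _ (h i r s h2.symm h1 h4.symm) (h j r s h3.symm h1 h5.symm)).1
  · exact (aux _ _ _ _ (h i r s h2.symm h1 h4.symm) (h j r s h3.symm h1 h5.symm)).2

lemma isOpen_LC7_lift (σ : ℕ × ℕ × ℕ × ℕ) :
    IsOpen {v : Fin 7 → Fin 3 → ℝ | ∃ h : General v, toConfig ⟨v, h⟩ ∈ LC7 σ} := by
  rw [isOpen_iff_mem_nhds]
  rintro v ⟨hv, hσ⟩
  have hopen : IsOpen {w : Fin 7 → Fin 3 → ℝ | ∀ i j k, i ≠ j → j ≠ k → i ≠ k →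
      0 < bracket (v i) (v j) (v k) * bracket (w i) (w j) (w k)} := by
    simp only [Set.ofPred_forall]
    refine isOpen_iInter_of_finite fun i => isOpen_iInter_of_finite fun j =>
      isOpen_iInter_of_finite fun k => isOpen_iInter_of_finite fun _ =>
      isOpen_iInter_of_finite fun _ => isOpen_iInter_of_finite fun _ =>
      isOpen_lt continuous_const ?_
    unfold bracket
    fun_prop
  refine Filter.mem_of_superset (hopen.mem_nhds fun i j k h1 h2 h3 =>
    mul_self_pos.2 (hv i j k h1 h2 h3)) ?_
  intro w hw
  have hwg : General w := fun i j k h1 h2 h3 h => by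
    have := hw i j k h1 h2 h3
    rw [h] at this
    simp at this
  refine ⟨hwg, isSimple_toConfig _, ?_⟩
  have hd : derivedCount w = derivedCount v := by
    funext m
    rw [derivedCount, derivedCount, bracketGraph_congr]
    intro i j k h1 h2 h3
    rw [mul_comm]
    exact hw i j k (Subtype.coe_injective.ne h1) (Subtype.coe_injective.ne h2)
      (Subtype.coe_injective.ne h3)
  rw [← hσ.2]
  simp only [derivativeCode, labelCount_toConfig, hd]

/-- The projection from nonzero vectors to the projective plane is open, because the saturation
of an open set is a union of its rescalings. -/
lemma isOpenMap_mk : IsOpenMap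
    (fun v : {v : Fin 3 → ℝ // v ≠ 0} => (Projectivization.mk ℝ v.1 v.2 : RP2)) := by
  intro U hU
  have : IsOpen ((fun v : {v : Fin 3 → ℝ // v ≠ 0} => (Projectivization.mk ℝ v.1 v.2 : RP2)) ⁻¹'
      ((fun v : {v : Fin 3 → ℝ // v ≠ 0} => (Projectivization.mk ℝ v.1 v.2 : RP2)) '' U)) := by
    have hU' : (fun v : {v : Fin 3 → ℝ // v ≠ 0} => (Projectivization.mk ℝ v.1 v.2 : RP2)) ⁻¹'
      ((fun v : {v : Fin 3 → ℝ // v ≠ 0} => (Projectivization.mk ℝ v.1 v.2 : RP2)) '' U) =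
      ⋃ a : ℝˣ, (fun v : {v : Fin 3 → ℝ // v ≠ 0} =>
        (⟨a • v.1, by simpa [smul_eq_zero_iff_eq] using v.2⟩ : {v : Fin 3 → ℝ // v ≠ 0})) ⁻¹' U := by
      ext v
      simp only [Set.mem_preimage, Set.mem_image, Set.mem_iUnion]
      constructor
      · rintro ⟨u, hu, huv⟩
        obtain ⟨a, ha⟩ := (Projectivization.mk_eq_mk_iff ℝ _ _ u.2 v.2).1 huv
        exact ⟨a, by convert hu⟩
      · rintro ⟨a, ha⟩
        exact ⟨_, ha, (Projectivization.mk_eq_mk_iff ℝ _ _ _ _).2 ⟨a, rfl⟩⟩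
    rw [hU']
    refine isOpen_iUnion fun a => hU.preimage ?_
    refine Continuous.subtype_mk ?_ _
    simp only [Units.smul_def]
    fun_prop
  exact this

lemma continuous_mk : Continuous
    (fun v : {v : Fin 3 → ℝ // v ≠ 0} => (Projectivization.mk ℝ v.1 v.2 : RP2)) :=
  continuous_coinduced_rng

lemma continuous_toConfig : Continuous toConfig := by
  have h1 : Continuous (Configuration.ofTuple (n := 7)) := continuous_coinduced_rng
  refine h1.comp (Continuous.subtype_mk (continuous_pi fun i => ?_) _)
  exact continuous_mk.comp (Continuous.subtype_mk
    ((continuous_apply i).comp continuous_subtype_val)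
    (fun v : {v : Fin 7 → Fin 3 → ℝ // General v} => v.2.ne_zero (by simp) i))

lemma isOpen_LC7 (σ : ℕ × ℕ × ℕ × ℕ) : IsOpen (LC7 σ) := by
  have : IsOpen (Configuration.ofTuple (n := 7) ⁻¹' LC7 σ) := by
    have hopen : IsOpen ((Pi.map fun (_ : Fin 7) (v : {v : Fin 3 → ℝ // v ≠ 0}) =>
        (Projectivization.mk ℝ v.1 v.2 : RP2)) ''
        ((fun x : Fin 7 → {v : Fin 3 → ℝ // v ≠ 0} => fun i => (x i).1) ⁻¹'
          {v : Fin 7 → Fin 3 → ℝ | ∃ h : General v, toConfig ⟨v, h⟩ ∈ LC7 σ})) := by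
      refine IsOpenMap.piMap (fun _ => isOpenMap_mk) (by simp) _ ((isOpen_LC7_lift σ).preimage ?_)
      fun_prop
    convert hopen.preimage (continuous_subtype_val (p := fun f : Fin 7 → RP2 =>
      Function.Injective f)) using 1
    ext f
    simp only [Set.mem_preimage, Set.mem_image, Set.mem_ofPred_eq]
    constructor
    · intro hf
      have hpt : pt (fun i => (f.1 i).rep) (fun i => (f.1 i).rep_nonzero) = f.1 := by
        funext i; exact (f.1 i).mk_rep
      have hg : General (fun i => (f.1 i).rep) := by
        rw [← isSimple_range_pt_iff (fun i => (f.1 i).rep_nonzero) (by rw [hpt]; exact f.2), hpt]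
        exact hf.1
      refine ⟨fun i => ⟨(f.1 i).rep, (f.1 i).rep_nonzero⟩, ⟨hg, ?_⟩, hpt⟩
      convert hf using 1
      ext1
      rw [toConfig_points _ (fun i => (f.1 i).rep_nonzero), hpt]
      rfl
    · rintro ⟨x, ⟨hg, hx⟩, hxf⟩
      convert hx using 1
      ext1
      rw [toConfig_points _ (fun i => (x i).2)]
      change Set.range f.1 = _
      rw [← hxf]
      rfl
  exact this

/-- A path of typical configurations stays in one class `LC⁷_σ`, since these classes are open and
disjoint. -/
lemma LC7_of_joinedIn {σ : ℕ × ℕ × ℕ × ℕ} {P P' : Configuration 7}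
    (h : JoinedIn (typicalConfigurations 7) P P') (hP : P ∈ LC7 σ) : P' ∈ LC7 σ := by
  obtain ⟨γ, hγ⟩ := h
  have hclopen : IsClopen (γ ⁻¹' LC7 σ) := by
    refine ⟨⟨?_⟩, (isOpen_LC7 σ).preimage γ.continuous⟩
    have : (γ ⁻¹' LC7 σ)ᶜ = γ ⁻¹' ⋃ σ' ∈ {σ' | σ' ≠ σ}, LC7 σ' := by
      ext t
      simp only [Set.mem_compl_iff, Set.mem_preimage, Set.mem_iUnion]
      constructor
      · intro ht
        exact ⟨_, fun e => ht ⟨(hγ t).1, e⟩, (hγ t).1, rfl⟩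
      · rintro ⟨σ', hne, ht⟩ ht'
        exact hne (ht.2.symm.trans ht'.2)
    rw [this]
    exact (isOpen_biUnion fun σ' _ => isOpen_LC7 σ').preimage γ.continuous
  have huniv := hclopen.eq_univ ⟨0, by simpa using hP⟩
  have : (1 : unitInterval) ∈ γ ⁻¹' LC7 σ := by rw [huniv]; trivial
  simpa using this

/-! ### Projective transformations -/

/-- Modulo sign, the invertible real `3 × 3` matrices form a path connected space: shears and
positive diagonal matrices are joined to the identity by lines, half turns by rotations. -/
lemma joinedIn_one_or_neg_one (M : Matrix (Fin 3) (Fin 3) ℝ) (hM : M.det ≠ 0) :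
    JoinedIn {M : Matrix (Fin 3) (Fin 3) ℝ | M.det ≠ 0} M 1 ∨
      JoinedIn {M : Matrix (Fin 3) (Fin 3) ℝ | M.det ≠ 0} M (-1) := by
  set F : Set (Matrix (Fin 3) (Fin 3) ℝ) := {M | M.det ≠ 0} with hF
  have hmul : ∀ A B C D : Matrix (Fin 3) (Fin 3) ℝ, JoinedIn F A B → JoinedIn F C D →
      JoinedIn F (A * C) (B * D) := by
    rintro A B C D ⟨γ, hγ⟩ ⟨δ, hδ⟩
    refine ⟨⟨⟨fun t => γ t * δ t, by fun_prop⟩, by simp, by simp⟩, fun t => ?_⟩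
    have h1 := hγ t
    have h2 := hδ t
    simp only [hF, Set.mem_ofPred_eq] at h1 h2 ⊢
    simpa using ⟨h1, h2⟩
  have hdiag : ∀ d e : Fin 3 → ℝ, (∀ i, 0 < d i * e i) →
      JoinedIn F (Matrix.diagonal d) (Matrix.diagonal e) := by
    intro d e hde
    refine JoinedIn.ofLine (f := fun t : ℝ => Matrix.diagonal ((1 - t) • d + t • e)) ?_ (by simp)
      (by simp) ?_
    · exact Continuous.continuousOn (Continuous.matrix_diagonal (by fun_prop))
    · rintro _ ⟨t, ⟨ht0, ht1⟩, rfl⟩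
      simp only [hF, Set.mem_ofPred_eq, Matrix.det_diagonal]
      refine Finset.prod_ne_zero_iff.2 fun i _ => ?_
      simp only [Pi.add_apply, Pi.smul_apply, smul_eq_mul]
      rcases pos_and_pos_or_neg_and_neg_of_mul_pos (hde i) with ⟨h1, h2⟩ | ⟨h1, h2⟩
      · rcases ht0.eq_or_lt with rfl | h
        · simpa using h1.ne'
        · nlinarith [mul_pos h h2, mul_nonneg (sub_nonneg.2 ht1) h1.le]
      · rcases ht0.eq_or_lt with rfl | h
        · simpa using h1.ne
        · nlinarith [mul_pos h (neg_pos.2 h2), mul_nonneg (sub_nonneg.2 ht1) (neg_pos.2 h1).le]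
  -- half turns about the coordinate axes
  have hrot : JoinedIn F (Matrix.diagonal ![1, -1, -1]) 1 ∧
      JoinedIn F (Matrix.diagonal ![-1, 1, -1]) 1 ∧
      JoinedIn F (Matrix.diagonal ![-1, -1, 1]) 1 := by
    have hcs : ∀ t : ℝ, Real.cos t * Real.cos t + Real.sin t * Real.sin t = 1 := fun t => by
      nlinarith [Real.sin_sq_add_cos_sq t]
    refine ⟨?_, ?_, ?_⟩
    · refine JoinedIn.ofLine (f := fun t : ℝ => !![1, 0, 0;
        0, Real.cos (Real.pi * (1 - t)), -Real.sin (Real.pi * (1 - t));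
        0, Real.sin (Real.pi * (1 - t)), Real.cos (Real.pi * (1 - t))]) ?_ ?_ ?_ ?_
      · refine Continuous.continuousOn (continuous_matrix fun i j => ?_)
        fin_cases i <;> fin_cases j <;> simp <;> fun_prop
      · ext i j; fin_cases i <;> fin_cases j <;> simp
      · ext i j; fin_cases i <;> fin_cases j <;> simp
      · rintro _ ⟨t, -, rfl⟩
        simp [hF, Matrix.det_fin_three, hcs]
    · refine JoinedIn.ofLine (f := fun t : ℝ => !![
        Real.cos (Real.pi * (1 - t)), 0, -Real.sin (Real.pi * (1 - t)); 0, 1, 0;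
        Real.sin (Real.pi * (1 - t)), 0, Real.cos (Real.pi * (1 - t))]) ?_ ?_ ?_ ?_
      · refine Continuous.continuousOn (continuous_matrix fun i j => ?_)
        fin_cases i <;> fin_cases j <;> simp <;> fun_prop
      · ext i j; fin_cases i <;> fin_cases j <;> simp
      · ext i j; fin_cases i <;> fin_cases j <;> simp
      · rintro _ ⟨t, -, rfl⟩
        simp [hF, Matrix.det_fin_three, hcs]
    · refine JoinedIn.ofLine (f := fun t : ℝ => !![
        Real.cos (Real.pi * (1 - t)), -Real.sin (Real.pi * (1 - t)), 0;
        Real.sin (Real.pi * (1 - t)), Real.cos (Real.pi * (1 - t)), 0; 0, 0, 1]) ?_ ?_ ?_ ?_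
      · refine Continuous.continuousOn (continuous_matrix fun i j => ?_)
        fin_cases i <;> fin_cases j <;> simp <;> fun_prop
      · ext i j; fin_cases i <;> fin_cases j <;> simp
      · ext i j; fin_cases i <;> fin_cases j <;> simp
      · rintro _ ⟨t, -, rfl⟩
        simp [hF, Matrix.det_fin_three, hcs]
  have hneg : ∀ A B : Matrix (Fin 3) (Fin 3) ℝ, JoinedIn F A B → JoinedIn F (-A) (-B) := by
    intro A B h
    have h1 : JoinedIn F (-1) (-1) := JoinedIn.refl (by simp [hF, Matrix.det_neg])
    simpa using hmul _ _ _ _ h1 h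
  refine Matrix.diagonal_transvection_induction_of_det_ne_zero
    (fun M => JoinedIn F M 1 ∨ JoinedIn F M (-1)) M hM ?_ ?_ ?_
  · intro d hd
    rw [Matrix.det_diagonal, Finset.prod_ne_zero_iff] at hd
    have hs : ∀ i, d i < 0 ∨ 0 < d i := fun i => lt_or_gt_of_ne (hd i (Finset.mem_univ i))
    have key : ∀ e : Fin 3 → ℝ, 0 < d 0 * e 0 → 0 < d 1 * e 1 → 0 < d 2 * e 2 →
        JoinedIn F (Matrix.diagonal d) (Matrix.diagonal e) := fun e h0 h1 h2 =>
      hdiag d e fun i => by fin_cases i <;> assumption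
    have e1 : (1 : Matrix (Fin 3) (Fin 3) ℝ) = Matrix.diagonal ![1, 1, 1] := by
      ext i j; fin_cases i <;> fin_cases j <;> simp
    have en : ∀ a b c : ℝ, Matrix.diagonal ![-a, -b, -c] = -Matrix.diagonal ![a, b, c] := by
      intro a b c
      ext i j; fin_cases i <;> fin_cases j <;> simp
    rcases hs 0 with h0 | h0 <;> rcases hs 1 with h1 | h1 <;> rcases hs 2 with h2 | h2
    · right
      rw [e1, ← en]
      exact key _ (by simpa) (by simpa) (by simpa)
    · left
      exact (key ![-1, -1, 1] (by simpa) (by simpa) (by simpa)).trans hrot.2.2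
    · left
      exact (key ![-1, 1, -1] (by simpa) (by simpa) (by simpa)).trans hrot.2.1
    · right
      refine (key ![-1, - -1, - -1] (by simpa) (by simpa) (by simpa)).trans ?_
      rw [en]
      exact hneg _ _ hrot.1
    · left
      exact (key ![1, -1, -1] (by simpa) (by simpa) (by simpa)).trans hrot.1
    · right
      refine (key ![- -1, -1, - -1] (by simpa) (by simpa) (by simpa)).trans ?_
      rw [en]
      exact hneg _ _ hrot.2.1
    · right
      refine (key ![- -1, - -1, -1] (by simpa) (by simpa) (by simpa)).trans ?_
      rw [en]
      exact hneg _ _ hrot.2.2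
    · left
      rw [e1]
      exact key _ (by simpa) (by simpa) (by simpa)
  · intro s
    left
    refine JoinedIn.ofLine (f := fun t : ℝ => Matrix.transvection s.i s.j ((1 - t) * s.c)) ?_ ?_ ?_ ?_
    · refine Continuous.continuousOn ?_
      unfold Matrix.transvection
      refine continuous_const.add (continuous_matrix fun i j => ?_)
      simp only [Matrix.single_apply]
      split_ifs <;> fun_prop
    · simp [Matrix.TransvectionStruct.toMatrix]
    · simp
    · rintro _ ⟨t, -, rfl⟩
      simp [hF, Matrix.det_transvection_of_ne _ _ s.hij]
  · intro A B _ _ hA hB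
    rcases hA with hA | hA <;> rcases hB with hB | hB
    · left; simpa using hmul _ _ _ _ hA hB
    · right; simpa using hmul _ _ _ _ hA hB
    · right; simpa using hmul _ _ _ _ hA hB
    · left; simpa using hmul _ _ _ _ hA hB

/-! ### Typical families -/

/-- A family of seven vectors representing a typical configuration: it is general, and no nonzero
quadratic form vanishes on six of its members. -/
structure Typical (v : Fin 7 → Fin 3 → ℝ) : Prop where
  general : General v
  not_coconic : ∀ m, ¬ ∃ Q : QuadraticForm ℝ (Fin 3 → ℝ), Q ≠ 0 ∧ ∀ i, i ≠ m → Q (v i) = 0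

lemma map_rep_eq_zero_iff (Q : QuadraticForm ℝ (Fin 3 → ℝ)) {u : Fin 3 → ℝ} (hu : u ≠ 0) :
    Q (Projectivization.mk ℝ u hu).rep = 0 ↔ Q u = 0 := by
  obtain ⟨a, ha⟩ := Projectivization.exists_smul_eq_mk_rep ℝ u hu
  rw [← ha, Units.smul_def, QuadraticMap.map_smul]
  simp

lemma isTypical_toConfig_iff (v : {v : Fin 7 → Fin 3 → ℝ // General v}) :
    toConfig v ∈ typicalConfigurations 7 ↔ Typical v.1 := by
  have h0 := v.2.ne_zero (by simp)
  have hinj := v.2.pt_injective (by simp) h0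
  constructor
  · rintro ⟨-, h⟩
    refine ⟨v.2, ?_⟩
    rintro m ⟨Q, hQ, hQv⟩
    refine h (pt v.1 h0 '' {i | i ≠ m}) ?_ ?_ ⟨Q, hQ, ?_⟩
    · rintro _ ⟨i, -, rfl⟩
      exact ⟨i, rfl⟩
    · rw [hinj.encard_image, show {i : Fin 7 | i ≠ m} = ((Finset.univ.erase m : Finset (Fin 7)) :
        Set (Fin 7)) by ext; simp, Set.encard_coe_eq_coe_finsetCard]
      simp
    · rintro _ ⟨i, hi, rfl⟩
      exact (map_rep_eq_zero_iff Q (h0 i)).2 (hQv i hi)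
  · intro h
    refine ⟨isSimple_toConfig v, ?_⟩
    rintro T hT hcard ⟨Q, hQ, hQT⟩
    rw [toConfig_points v h0] at hT
    obtain ⟨m, hm⟩ : ∃ m, ∀ i, i ≠ m → pt v.1 h0 i ∈ T := by
      have hfin : (Set.range (pt v.1 h0)).Finite := Set.finite_range _
      have hc : (Set.range (pt v.1 h0)).encard = 7 := by
        rw [← Set.image_univ, hinj.encard_image, Set.encard_univ]; simp
      have := Set.encard_sdiff_add_encard_of_subset hT
      rw [hc, hcard] at this
      have h1 : (Set.range (pt v.1 h0) \ T).encard = 1 := by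
        have h7 : (7 : ℕ∞) = 1 + 6 := by norm_num
        rw [h7] at this
        exact (ENat.add_left_injective_of_ne_top (n := 6) (by decide)) this
      obtain ⟨x, hx⟩ := Set.encard_eq_one.1 h1
      obtain ⟨m, rfl⟩ : x ∈ Set.range (pt v.1 h0) := by
        have : x ∈ Set.range (pt v.1 h0) \ T := by rw [hx]; rfl
        exact this.1
      refine ⟨m, fun i hi => ?_⟩
      by_contra hiT
      have : pt v.1 h0 i ∈ Set.range (pt v.1 h0) \ T := ⟨⟨i, rfl⟩, hiT⟩
      rw [hx] at this
      exact hi (hinj this)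
    exact h.not_coconic m ⟨Q, hQ, fun i hi => (map_rep_eq_zero_iff Q (h0 i)).1 (hQT _ (hm i hi))⟩

/-- Two typical families are Q-equivalent if the configurations they represent are joined by a path
of typical configurations. -/
def QEquivalent (v w : Fin 7 → Fin 3 → ℝ) : Prop :=
  ∃ (hv : General v) (hw : General w),
    JoinedIn (typicalConfigurations 7) (toConfig ⟨v, hv⟩) (toConfig ⟨w, hw⟩)

lemma QEquivalent.symm {v w : Fin 7 → Fin 3 → ℝ} (h : QEquivalent v w) : QEquivalent w v := by
  obtain ⟨hv, hw, h⟩ := h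
  exact ⟨hw, hv, h.symm⟩

lemma QEquivalent.trans {u v w : Fin 7 → Fin 3 → ℝ} (h : QEquivalent u v) (h' : QEquivalent v w) :
    QEquivalent u w := by
  obtain ⟨hu, hv, h⟩ := h
  obtain ⟨_, hw, h'⟩ := h'
  exact ⟨hu, hw, h.trans h'⟩

/-- A path of typical families gives a path of typical configurations. -/
lemma qEquivalent_of_joinedIn {v w : Fin 7 → Fin 3 → ℝ} (h : JoinedIn {v | Typical v} v w) :
    QEquivalent v w := by
  refine ⟨h.source_mem.general, h.target_mem.general, ?_⟩
  obtain ⟨γ, hγ⟩ := h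
  refine ⟨⟨⟨fun t => toConfig ⟨γ t, (hγ t).general⟩, ?_⟩, ?_, ?_⟩, fun t => ?_⟩
  · exact continuous_toConfig.comp (Continuous.subtype_mk γ.continuous _)
  · simp
  · simp
  · exact (isTypical_toConfig_iff ⟨γ t, (hγ t).general⟩).2 (hγ t)

/-- Permuting and rescaling the vectors does not change the configuration. -/
lemma toConfig_perm_smul {v w : Fin 7 → Fin 3 → ℝ} (hv : General v) (hw : General w)
    (τ : Equiv.Perm (Fin 7)) (ε : Fin 7 → ℝ) (h : ∀ i, w i = ε i • v (τ i)) :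
    toConfig ⟨w, hw⟩ = toConfig ⟨v, hv⟩ := by
  have hv0 := hv.ne_zero (by simp)
  have hw0 := hw.ne_zero (by simp)
  ext1
  rw [toConfig_points ⟨w, hw⟩ hw0, toConfig_points ⟨v, hv⟩ hv0,
    ← τ.surjective.range_comp (pt v hv0)]
  congr 1
  funext i
  exact (Projectivization.mk_eq_mk_iff' ℝ _ _ _ _).2 ⟨ε i, (h i).symm⟩

lemma General.perm_smul {v w : Fin 7 → Fin 3 → ℝ} (hv : General v) (τ : Equiv.Perm (Fin 7))
    (ε : Fin 7 → ℝ) (hε : ∀ i, ε i ≠ 0) (h : ∀ i, w i = ε i • v (τ i)) : General w := by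
  rw [show w = fun i => ε i • (v ∘ τ) i from funext h]
  exact (hv.comp τ.injective).smul hε

lemma Typical.qEquivalent_perm_smul {v w : Fin 7 → Fin 3 → ℝ} (hv : Typical v)
    (τ : Equiv.Perm (Fin 7)) (ε : Fin 7 → ℝ) (hε : ∀ i, ε i ≠ 0) (h : ∀ i, w i = ε i • v (τ i)) :
    QEquivalent v w := by
  have hw := hv.general.perm_smul τ ε hε h
  refine ⟨hv.general, hw, ?_⟩
  rw [toConfig_perm_smul hv.general hw τ ε h]
  exact JoinedIn.refl ((isTypical_toConfig_iff _).2 hv)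

lemma QEquivalent.typical {v w : Fin 7 → Fin 3 → ℝ} (h : QEquivalent v w) : Typical w := by
  obtain ⟨hv, hw, h⟩ := h
  exact (isTypical_toConfig_iff ⟨w, hw⟩).1 h.target_mem

lemma Typical.mulVec {v : Fin 7 → Fin 3 → ℝ} (hv : Typical v) {M : Matrix (Fin 3) (Fin 3) ℝ}
    (hM : M.det ≠ 0) : Typical fun i => M.mulVec (v i) := by
  refine ⟨fun i j k h1 h2 h3 => ?_, ?_⟩
  · rw [bracket_mulVec]
    exact mul_ne_zero hM (hv.general i j k h1 h2 h3)
  · rintro m ⟨Q, hQ, h⟩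
    refine hv.not_coconic m ⟨Q.comp M.mulVecLin, fun h0 => hQ ?_, fun i hi => by
      simpa using h i hi⟩
    ext x
    have hMu : IsUnit M.det := isUnit_iff_ne_zero.2 hM
    have := congrArg (fun Q' : QuadraticForm ℝ (Fin 3 → ℝ) => Q' (M⁻¹.mulVec x)) h0
    simpa [Matrix.mulVec_mulVec, Matrix.mul_nonsing_inv _ hMu] using this

/-- Projectively equivalent typical families are Q-equivalent, because `PGL(3, ℝ)` is. -/
lemma Typical.qEquivalent_mulVec {v : Fin 7 → Fin 3 → ℝ} (hv : Typical v)
    {M : Matrix (Fin 3) (Fin 3) ℝ} (hM : M.det ≠ 0) :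
    QEquivalent v fun i => M.mulVec (v i) := by
  have hcont : Continuous fun (A : Matrix (Fin 3) (Fin 3) ℝ) (i : Fin 7) => A.mulVec (v i) := by
    fun_prop
  have key : ∀ N, JoinedIn {M : Matrix (Fin 3) (Fin 3) ℝ | M.det ≠ 0} M N →
      QEquivalent (fun i => M.mulVec (v i)) fun i => N.mulVec (v i) := fun N h =>
    qEquivalent_of_joinedIn ((h.map hcont).mono (by
      rintro _ ⟨A, hA, rfl⟩
      exact hv.mulVec hA))
  rcases joinedIn_one_or_neg_one M hM with h | h
  · simpa using (key 1 h).symm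
  · refine (hv.qEquivalent_perm_smul (Equiv.refl _) (fun _ => -1) (by simp) ?_).trans (key _ h).symm
    intro i
    simp [Matrix.neg_mulVec]

/-! ### The normal form -/

/-- The normal form of a seven-point configuration: two points on each coordinate line and the
point `(1 : 1 : 1)`. For positive parameters the six points lie on the sides of the coordinate
triangle that do not bound the region of `(1 : 1 : 1)`. -/
def normalForm (a a' b b' c c' : ℝ) : Fin 7 → Fin 3 → ℝ :=
  ![![0, 1, -a], ![0, 1, -a'], ![-b, 0, 1], ![-b', 0, 1], ![1, -c, 0], ![1, -c', 0], ![1, 1, 1]]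

lemma general_of_lt {v : Fin 7 → Fin 3 → ℝ}
    (h : ∀ i j k, i < j → j < k → bracket (v i) (v j) (v k) ≠ 0) : General v := by
  intro i j k hij hjk hik
  rcases lt_or_gt_of_ne hij with h1 | h1 <;> rcases lt_or_gt_of_ne hjk with h2 | h2 <;>
    rcases lt_or_gt_of_ne hik with h3 | h3
  · exact h _ _ _ h1 h2
  · exact absurd (h1.trans h2) h3.not_gt
  · have := h _ _ _ h3 h2
    rwa [bracket_swap_right, neg_ne_zero] at this
  · have := h _ _ _ h3 h1
    rwa [← bracket_rotate] at this
  · have := h _ _ _ h1 h3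
    rwa [bracket_swap_left, neg_ne_zero] at this
  · have := h _ _ _ h2 h3
    rwa [bracket_rotate] at this
  · exact absurd (h2.trans h1) h3.not_gt
  · have := h _ _ _ h2 h1
    rwa [← bracket_rotate, bracket_swap_left, neg_ne_zero] at this

lemma general_normalForm {a a' b b' c c' : ℝ} (ha : 0 < a) (hb : 0 < b) (hc : 0 < c)
    (hbb : b < b') (hcc : c < c') (h : a * b' * c' < 1) (h' : 1 < a' * b * c) :
    General (normalForm a a' b b' c c') := by
  have hb' : 0 < b' := hb.trans hbb
  have hc' : 0 < c' := hc.trans hcc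
  have hbc : 0 < b * c := mul_pos hb hc
  have e1 : b * c < b' * c := mul_lt_mul_of_pos_right hbb hc
  have e2 : b * c < b * c' := mul_lt_mul_of_pos_left hcc hb
  have e3 : b' * c < b' * c' := mul_lt_mul_of_pos_left hcc hb'
  have e4 : b * c' < b' * c' := mul_lt_mul_of_pos_right hbb hc'
  have ha' : 0 < a' := by
    by_contra! hle
    have := mul_nonneg (neg_nonneg.2 hle) hbc.le
    linarith
  have haa : a < a' := by
    have h1 : a * (b * c) < a * (b' * c') := mul_lt_mul_of_pos_left (e1.trans e3) ha
    have : a * (b * c) < a' * (b * c) := by linarith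
    exact lt_of_mul_lt_mul_right this hbc.le
  have f1 := mul_lt_mul_of_pos_left e1 ha
  have f2 := mul_lt_mul_of_pos_left e2 ha
  have f3 := mul_lt_mul_of_pos_left e3 ha
  have f4 := mul_lt_mul_of_pos_left e4 ha
  have g1 := mul_lt_mul_of_pos_left e1 ha'
  have g2 := mul_lt_mul_of_pos_left e2 ha'
  have g3 := mul_lt_mul_of_pos_left e3 ha'
  have g4 := mul_lt_mul_of_pos_left e4 ha'
  have k1 := mul_lt_mul_of_pos_right haa hb
  have k2 := mul_lt_mul_of_pos_right haa hb'
  have k3 := mul_lt_mul_of_pos_right hbb hc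
  have k4 := mul_lt_mul_of_pos_right hbb hc'
  have k5 := mul_lt_mul_of_pos_right hcc ha
  have k6 := mul_lt_mul_of_pos_right hcc ha'
  have l1 := mul_pos ha hb
  have l2 := mul_pos ha hb'
  have l3 := mul_pos ha' hb
  have l4 := mul_pos ha' hb'
  have l5 := mul_pos ha hc
  have l6 := mul_pos ha hc'
  have l7 := mul_pos ha' hc
  have l8 := mul_pos ha' hc'
  refine general_of_lt fun i j k hij hjk => ?_
  fin_cases i <;> fin_cases j <;> first
    | exact absurd hij (by decide)
    | (fin_cases k <;> first
      | exact absurd hjk (by decide)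
      | (simp only [normalForm, bracket, Fin.reduceFinMk, Matrix.cons_val, Fin.isValue]
         intro h0
         linarith))

lemma quadraticForm_apply (Q : QuadraticForm ℝ (Fin 3 → ℝ)) : ∃ p q r s t w : ℝ,
    (∀ u, Q u = p * u 0 ^ 2 + q * u 1 ^ 2 + r * u 2 ^ 2 + s * (u 0 * u 1) + t * (u 0 * u 2)
      + w * (u 1 * u 2)) := by
  refine ⟨Q (Pi.single 0 1), Q (Pi.single 1 1), Q (Pi.single 2 1),
    QuadraticMap.polar Q (Pi.single 0 1) (Pi.single 1 1),
    QuadraticMap.polar Q (Pi.single 0 1) (Pi.single 2 1),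
    QuadraticMap.polar Q (Pi.single 1 1) (Pi.single 2 1), fun u => ?_⟩
  have hu : u = u 0 • Pi.single 0 1 + u 1 • Pi.single 1 1 + u 2 • Pi.single 2 1 := by
    ext i; fin_cases i <;> simp
  conv_lhs => rw [hu]
  rw [QuadraticMap.map_add Q, QuadraticMap.map_add Q, QuadraticMap.polar_add_left,
    QuadraticMap.map_smul, QuadraticMap.map_smul, QuadraticMap.map_smul]
  simp only [QuadraticMap.polar_smul_left, QuadraticMap.polar_smul_right, smul_eq_mul]
  ring

/-- The symmetric functions of the roots of a quadratic trinomial. -/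
lemma vieta {q w r a a' : ℝ} (h : q - w * a + r * a ^ 2 = 0) (h' : q - w * a' + r * a' ^ 2 = 0)
    (hne : a ≠ a') : w = r * (a + a') ∧ q = r * (a * a') := by
  have hw : w = r * (a + a') := by
    have : (a - a') * (w - r * (a + a')) = 0 := by linear_combination h' - h
    rcases mul_eq_zero.1 this with h0 | h0
    · exact absurd (sub_eq_zero.1 h0) hne
    · linarith
  exact ⟨hw, by rw [hw] at h; linear_combination h⟩

/-- A conic through two points on each of two coordinate lines and one point on the third has
coefficients of one sign, so it misses `(1 : 1 : 1)`. -/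
lemma coeff_eq_zero {p q r s t w a a' b b' c : ℝ} (ha : 0 < a) (ha' : 0 < a') (hb : 0 < b)
    (hb' : 0 < b') (hc : 0 < c) (haa : a ≠ a') (hbb : b ≠ b')
    (hA : q - w * a + r * a ^ 2 = 0) (hA' : q - w * a' + r * a' ^ 2 = 0)
    (hB : r - t * b + p * b ^ 2 = 0) (hB' : r - t * b' + p * b' ^ 2 = 0)
    (hC : p - s * c + q * c ^ 2 = 0) (hp : p + q + r + s + t + w = 0) :
    p = 0 ∧ q = 0 ∧ r = 0 ∧ s = 0 ∧ t = 0 ∧ w = 0 := by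
  obtain ⟨hw, hq⟩ := vieta hA hA' haa
  obtain ⟨ht, hr⟩ := vieta hB hB' hbb
  have hs : s = p * ((1 + b * b' * (a * a') * c ^ 2) / c) := by
    rw [hq, hr] at hC
    field_simp
    linear_combination -hC
  have hp0 : p * (1 + b * b' * (a * a') + b * b' + (1 + b * b' * (a * a') * c ^ 2) / c + (b + b')
      + b * b' * (a + a')) = 0 := by
    rw [hs, ht, hw, hq, hr] at hp
    linear_combination hp
  have : p = 0 := by
    refine (mul_eq_zero.1 hp0).resolve_right ?_
    positivity
  subst this
  simp_all

lemma typical_normalForm {a a' b b' c c' : ℝ} (ha : 0 < a) (hb : 0 < b) (hc : 0 < c)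
    (hbb : b < b') (hcc : c < c') (h : a * b' * c' < 1) (h' : 1 < a' * b * c)
    (hprod : a * a' * (b * b') * (c * c') ≠ 1) : Typical (normalForm a a' b b' c c') := by
  have hb' : 0 < b' := hb.trans hbb
  have hc' : 0 < c' := hc.trans hcc
  have ha' : 0 < a' := by
    by_contra! hle
    have := mul_nonneg (neg_nonneg.2 hle) (mul_pos hb hc).le
    linarith
  have haa : a ≠ a' := by
    rintro rfl
    have := mul_lt_mul'' hbb hcc hb.le hc.le
    have := mul_lt_mul_of_pos_left this ha
    linarith
  refine ⟨general_normalForm ha hb hc hbb hcc h h', ?_⟩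
  rintro m ⟨Q, hQ, hQv⟩
  obtain ⟨p, q, r, s, t, w, hco⟩ := quadraticForm_apply Q
  apply hQ
  suffices p = 0 ∧ q = 0 ∧ r = 0 ∧ s = 0 ∧ t = 0 ∧ w = 0 by
    obtain ⟨rfl, rfl, rfl, rfl, rfl, rfl⟩ := this
    ext u
    simp [hco]
  have h0 : 0 ≠ m → q - w * a + r * a ^ 2 = 0 := fun hm => by
    have := hQv 0 hm
    simp [hco, normalForm] at this; linarith
  have h1 : 1 ≠ m → q - w * a' + r * a' ^ 2 = 0 := fun hm => by
    have := hQv 1 hm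
    simp [hco, normalForm] at this; linarith
  have h2 : 2 ≠ m → r - t * b + p * b ^ 2 = 0 := fun hm => by
    have := hQv 2 hm
    simp [hco, normalForm] at this; linarith
  have h3 : 3 ≠ m → r - t * b' + p * b' ^ 2 = 0 := fun hm => by
    have := hQv 3 hm
    simp [hco, normalForm] at this; linarith
  have h4 : 4 ≠ m → p - s * c + q * c ^ 2 = 0 := fun hm => by
    have := hQv 4 hm
    simp [hco, normalForm] at this; linarith
  have h5 : 5 ≠ m → p - s * c' + q * c' ^ 2 = 0 := fun hm => by
    have := hQv 5 hm
    simp [hco, normalForm] at this; linarith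
  have h6 : 6 ≠ m → p + q + r + s + t + w = 0 := fun hm => by
    have := hQv 6 hm
    simp [hco, normalForm] at this; linarith
  fin_cases m
  · obtain ⟨x1, x2, x3, x4, x5, x6⟩ := coeff_eq_zero hb hb' hc hc' ha' hbb.ne hcc.ne
      (h2 (by decide)) (h3 (by decide)) (h4 (by decide)) (h5 (by decide)) (h1 (by decide))
      (by linarith [h6 (by decide)])
    exact ⟨x3, x1, x2, x5, x6, x4⟩
  · obtain ⟨x1, x2, x3, x4, x5, x6⟩ := coeff_eq_zero hb hb' hc hc' ha hbb.ne hcc.ne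
      (h2 (by decide)) (h3 (by decide)) (h4 (by decide)) (h5 (by decide)) (h0 (by decide))
      (by linarith [h6 (by decide)])
    exact ⟨x3, x1, x2, x5, x6, x4⟩
  · obtain ⟨x1, x2, x3, x4, x5, x6⟩ := coeff_eq_zero hc hc' ha ha' hb' hcc.ne haa
      (h4 (by decide)) (h5 (by decide)) (h0 (by decide)) (h1 (by decide)) (h3 (by decide))
      (by linarith [h6 (by decide)])
    exact ⟨x2, x3, x1, x6, x4, x5⟩
  · obtain ⟨x1, x2, x3, x4, x5, x6⟩ := coeff_eq_zero hc hc' ha ha' hb hcc.ne haa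
      (h4 (by decide)) (h5 (by decide)) (h0 (by decide)) (h1 (by decide)) (h2 (by decide))
      (by linarith [h6 (by decide)])
    exact ⟨x2, x3, x1, x6, x4, x5⟩
  · exact coeff_eq_zero ha ha' hb hb' hc' haa hbb.ne
      (h0 (by decide)) (h1 (by decide)) (h2 (by decide)) (h3 (by decide)) (h5 (by decide))
      (h6 (by decide))
  · exact coeff_eq_zero ha ha' hb hb' hc haa hbb.ne
      (h0 (by decide)) (h1 (by decide)) (h2 (by decide)) (h3 (by decide)) (h4 (by decide))
      (h6 (by decide))
  · -- the six points off `(1 : 1 : 1)`: Carnot's theorem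
    obtain ⟨hw, hq⟩ := vieta (h0 (by decide)) (h1 (by decide)) haa
    obtain ⟨ht, hr⟩ := vieta (h2 (by decide)) (h3 (by decide)) hbb.ne
    obtain ⟨hs, hp⟩ := vieta (h4 (by decide)) (h5 (by decide)) hcc.ne
    have : p * (a * a' * (b * b') * (c * c') - 1) = 0 := by
      rw [hq, hr] at hp
      linear_combination -hp
    have hp0 : p = 0 := (mul_eq_zero.1 this).resolve_right (sub_ne_zero.2 hprod)
    have hr0 : r = 0 := by rw [hr, hp0, zero_mul]
    have hq0 : q = 0 := by rw [hq, hr0, zero_mul]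
    exact ⟨hp0, hq0, hr0, by rw [hs, hq0, zero_mul], by rw [ht, hp0, zero_mul],
      by rw [hw, hr0, zero_mul]⟩

/-- Carnot's theorem: if the product of the six parameters is one, then the six points on the
coordinate lines lie on a conic. -/
lemma prod_ne_one_of_typical {a a' b b' c c' : ℝ} (h : Typical (normalForm a a' b b' c c')) :
    a * a' * (b * b') * (c * c') ≠ 1 := by
  intro h1
  let π : Fin 3 → (Fin 3 → ℝ) →ₗ[ℝ] ℝ := fun i => LinearMap.proj i
  let r := b * b'
  let q := r * (a * a')
  obtain ⟨Q, hQ⟩ : ∃ Q : QuadraticForm ℝ (Fin 3 → ℝ), ∀ u, Q u = u 0 * u 0 + q * (u 1 * u 1)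
      + r * (u 2 * u 2) + q * (c + c') * (u 0 * u 1) + (b + b') * (u 0 * u 2)
      + r * (a + a') * (u 1 * u 2) :=
    ⟨QuadraticMap.linMulLin (π 0) (π 0)
      + q • QuadraticMap.linMulLin (π 1) (π 1) + r • QuadraticMap.linMulLin (π 2) (π 2)
      + (q * (c + c')) • QuadraticMap.linMulLin (π 0) (π 1)
      + (b + b') • QuadraticMap.linMulLin (π 0) (π 2)
      + (r * (a + a')) • QuadraticMap.linMulLin (π 1) (π 2), fun u => by simp [π]⟩
  refine h.not_coconic 6 ⟨Q, fun h0 => ?_, fun i hi => ?_⟩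
  · have := hQ ![1, 0, 0]
    rw [h0] at this
    simp at this
  · rw [hQ]
    fin_cases i <;> simp [normalForm, q, r] at hi ⊢
    · ring
    · ring
    · ring
    · ring
    · linear_combination -h1
    · linear_combination -h1

/-- The logarithms of the parameters of the normal forms under consideration. -/
def logCone : Set (Fin 6 → ℝ) :=
  {k | k 2 < k 3 ∧ k 4 < k 5 ∧ k 0 + k 3 + k 5 < 0 ∧ 0 < k 1 + k 2 + k 4}

/-- The normal form as a function of the logarithms of its parameters. -/
noncomputable def expForm (k : Fin 6 → ℝ) : Fin 7 → Fin 3 → ℝ :=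
  normalForm (Real.exp (k 0)) (Real.exp (k 1)) (Real.exp (k 2)) (Real.exp (k 3)) (Real.exp (k 4))
    (Real.exp (k 5))

/-- The sum of the logarithms of the parameters; it vanishes exactly when the six points on the
coordinate lines are coconic. -/
def total (k : Fin 6 → ℝ) : ℝ := k 0 + k 1 + (k 2 + k 3) + (k 4 + k 5)

lemma typical_expForm {k : Fin 6 → ℝ} (hk : k ∈ logCone) (h : total k ≠ 0) :
    Typical (expForm k) := by
  obtain ⟨h1, h2, h3, h4⟩ := hk
  refine typical_normalForm (Real.exp_pos _) (Real.exp_pos _) (Real.exp_pos _)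
    (Real.exp_lt_exp.2 h1) (Real.exp_lt_exp.2 h2) ?_ ?_ ?_
  · rwa [← Real.exp_add, ← Real.exp_add, Real.exp_lt_one_iff]
  · rwa [← Real.exp_add, ← Real.exp_add, Real.one_lt_exp_iff]
  · simpa only [← Real.exp_add, ne_eq, Real.exp_eq_one_iff, total] using h

lemma continuous_expForm : Continuous expForm := by
  refine continuous_pi fun i => continuous_pi fun j => ?_
  fin_cases i <;> fin_cases j <;> simp [expForm, normalForm] <;> fun_prop

lemma qEquivalent_expForm_of_pos {k l : Fin 6 → ℝ} (hk : k ∈ logCone) (hl : l ∈ logCone)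
    (hk' : 0 < total k) (hl' : 0 < total l) : QEquivalent (expForm k) (expForm l) := by
  have hconv : Convex ℝ {k | k ∈ logCone ∧ 0 < total k} := by
    rintro x ⟨⟨x1, x2, x3, x4⟩, x5⟩ y ⟨⟨y1, y2, y3, y4⟩, y5⟩ s t hs ht hst
    simp only [logCone, total, Set.mem_ofPred_eq, Pi.add_apply, Pi.smul_apply, smul_eq_mul]
      at x1 x2 x3 x4 x5 y1 y2 y3 y4 y5 ⊢
    have key : ∀ u u' : ℝ, 0 < u → 0 < u' → 0 < s * u + t * u' := by
      intro u u' hu hu'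
      rcases hs.eq_or_lt with rfl | hs'
      · have : t = 1 := by linarith
        subst this; linarith
      · have := mul_pos hs' hu
        have := mul_nonneg ht hu'.le
        linarith
    refine ⟨⟨?_, ?_, ?_, ?_⟩, ?_⟩
    · linarith [key _ _ (sub_pos.2 x1) (sub_pos.2 y1)]
    · linarith [key _ _ (sub_pos.2 x2) (sub_pos.2 y2)]
    · linarith [key _ _ (neg_pos.2 x3) (neg_pos.2 y3)]
    · linarith [key _ _ x4 y4]
    · linarith [key _ _ x5 y5]
  have := (hconv.isPathConnected ⟨k, hk, hk'⟩).joinedIn k ⟨hk, hk'⟩ l ⟨hl, hl'⟩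
  refine qEquivalent_of_joinedIn ((this.map continuous_expForm).mono ?_)
  rintro _ ⟨x, hx, rfl⟩
  exact typical_expForm hx.1 hx.2.ne'

/-- Exchanging the last two coordinates negates the logarithms of the parameters, and so exchanges
the two sides of the locus of coconic sextuples. -/
lemma qEquivalent_expForm_neg {k : Fin 6 → ℝ} (hk : k ∈ logCone) (h : total k ≠ 0) :
    QEquivalent (expForm k) (expForm ![-k 1, -k 0, -k 5, -k 4, -k 3, -k 2]) := by
  have hdet : (!![1, 0, 0; 0, 0, 1; 0, 1, 0] : Matrix (Fin 3) (Fin 3) ℝ).det ≠ 0 := by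
    simp [Matrix.det_fin_three]
  have hE := (typical_expForm hk h).qEquivalent_mulVec hdet
  refine hE.trans (hE.typical.qEquivalent_perm_smul
    ⟨![1, 0, 5, 4, 3, 2, 6], ![1, 0, 5, 4, 3, 2, 6], by decide, by decide⟩
    ![-Real.exp (-k 1), -Real.exp (-k 0), -Real.exp (-k 5), -Real.exp (-k 4), -Real.exp (-k 3),
      -Real.exp (-k 2), 1] ?_ ?_)
  · intro i
    fin_cases i <;> simp [Real.exp_ne_zero]
  · intro i
    ext j
    fin_cases i <;> fin_cases j <;>
      simp [expForm, normalForm, ← Real.exp_add]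

lemma qEquivalent_expForm {k l : Fin 6 → ℝ} (hk : k ∈ logCone) (hl : l ∈ logCone)
    (hk' : total k ≠ 0) (hl' : total l ≠ 0) : QEquivalent (expForm k) (expForm l) := by
  have key : ∀ k ∈ logCone, total k ≠ 0 → ∃ k' ∈ logCone, 0 < total k' ∧
      QEquivalent (expForm k) (expForm k') := by
    intro k hk h
    rcases lt_or_gt_of_ne h with h0 | h0
    · refine ⟨_, ?_, ?_, qEquivalent_expForm_neg hk h⟩
      · obtain ⟨h1, h2, h3, h4⟩ := hk
        refine ⟨?_, ?_, ?_, ?_⟩ <;> simp <;> linarith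
      · simp [total] at h0 ⊢
        linarith
    · exact ⟨k, hk, h0, qEquivalent_expForm_of_pos hk hk h0 h0⟩
  obtain ⟨k', h1, h2, h3⟩ := key k hk hk'
  obtain ⟨l', h4, h5, h6⟩ := key l hl hl'
  exact (h3.trans (qEquivalent_expForm_of_pos h1 h4 h2 h5)).trans h6.symm

/-! ### Reduction to the normal form -/

lemma exists_expForm_of_normalForm {a a' b b' c c' : ℝ} (ha : 0 < a) (ha' : 0 < a') (hb : 0 < b)
    (hb' : 0 < b') (hc : 0 < c) (hc' : 0 < c')
    (hT : Typical (normalForm a a' b b' c c'))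
    (h1 : a * b * c < 1) (h2 : a * b * c' < 1) (h3 : a * b' * c < 1) (h4 : a * b' * c' < 1)
    (h5 : 1 < a' * b * c) (h6 : 1 < a' * b * c') (h7 : 1 < a' * b' * c) (h8 : 1 < a' * b' * c') :
    ∃ k ∈ logCone, total k ≠ 0 ∧ QEquivalent (normalForm a a' b b' c c') (expForm k) := by
  wlog hbb : b < b' generalizing b b' c c'
  · have hne : b ≠ b' := by
      rintro rfl
      refine hT.general 2 3 6 (by decide) (by decide) (by decide) ?_
      simp [normalForm]
    have hE : QEquivalent (normalForm a a' b b' c c') (normalForm a a' b' b c c') :=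
      hT.qEquivalent_perm_smul ⟨![0, 1, 3, 2, 4, 5, 6], ![0, 1, 3, 2, 4, 5, 6], by decide, by decide⟩
        (fun _ => 1) (by simp) (by intro i; fin_cases i <;> simp [normalForm])
    obtain ⟨k, hk, hk', h⟩ := this hb' hb hc hc' hE.typical h3 h4 h1 h2 h7 h8 h5 h6
      (lt_of_le_of_ne (not_lt.1 hbb) hne.symm)
    exact ⟨k, hk, hk', hE.trans h⟩
  wlog hcc : c < c' generalizing c c'
  · have hne : c ≠ c' := by
      rintro rfl
      refine hT.general 4 5 6 (by decide) (by decide) (by decide) ?_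
      simp [normalForm]
    have hE : QEquivalent (normalForm a a' b b' c c') (normalForm a a' b b' c' c) :=
      hT.qEquivalent_perm_smul ⟨![0, 1, 2, 3, 5, 4, 6], ![0, 1, 2, 3, 5, 4, 6], by decide, by decide⟩
        (fun _ => 1) (by simp) (by intro i; fin_cases i <;> simp [normalForm])
    obtain ⟨k, hk, hk', h⟩ := this hc' hc hE.typical h2 h1 h4 h3 h6 h5 h8 h7
      (lt_of_le_of_ne (not_lt.1 hcc) hne.symm)
    exact ⟨k, hk, hk', hE.trans h⟩
  have hform : expForm ![Real.log a, Real.log a', Real.log b, Real.log b', Real.log c, Real.log c']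
      = normalForm a a' b b' c c' := by
    simp [expForm, Real.exp_log, *]
  refine ⟨![Real.log a, Real.log a', Real.log b, Real.log b', Real.log c, Real.log c'],
    ⟨Real.log_lt_log hb hbb, Real.log_lt_log hc hcc, ?_, ?_⟩, ?_, ?_⟩
  · have := Real.log_neg (by positivity) h4
    rwa [Real.log_mul (by positivity) hc'.ne', Real.log_mul ha.ne' hb'.ne'] at this
  · have := Real.log_pos h5
    rwa [Real.log_mul (by positivity) hc.ne', Real.log_mul ha'.ne' hb.ne'] at this
  · intro h0
    refine prod_ne_one_of_typical hT ?_
    apply Real.eq_one_of_pos_of_log_eq_zero (by positivity)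
    rw [Real.log_mul (by positivity) (by positivity), Real.log_mul (by positivity) (by positivity),
      Real.log_mul ha.ne' ha'.ne', Real.log_mul hb.ne' hb'.ne', Real.log_mul hc.ne' hc'.ne']
    exact h0
  · rw [hform]
    exact hT.qEquivalent_perm_smul (Equiv.refl _) (fun _ => 1) (by simp) (by simp)

/-- The sign conditions on the brackets of `v = (A, A', B, B', C, C', p)` that put it into a normal
form with `a b c < 1 < a' b c` for every choice of `b` and `c`. -/
structure NormalSigns (v : Fin 7 → Fin 3 → ℝ) : Prop where
  onA : ∀ i, i = 0 ∨ i = 1 → bracket (v 2) (v 3) (v i) * bracket (v 4) (v 5) (v i) *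
    (bracket (v 2) (v 3) (v 6) * bracket (v 4) (v 5) (v 6)) < 0
  onB : ∀ j, j = 2 ∨ j = 3 → bracket (v 0) (v 1) (v j) * bracket (v 4) (v 5) (v j) *
    (bracket (v 0) (v 1) (v 6) * bracket (v 4) (v 5) (v 6)) < 0
  onC : ∀ k, k = 4 ∨ k = 5 → bracket (v 0) (v 1) (v k) * bracket (v 2) (v 3) (v k) *
    (bracket (v 0) (v 1) (v 6) * bracket (v 2) (v 3) (v 6)) < 0
  first : ∀ j k, j = 2 ∨ j = 3 → k = 4 ∨ k = 5 →
    0 < bracket (v 0) (v j) (v k) * bracket (v 0) (v j) (v 6) *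
      (bracket (v 0) (v 1) (v k) * bracket (v 0) (v 1) (v 6))
  second : ∀ j k, j = 2 ∨ j = 3 → k = 4 ∨ k = 5 →
    bracket (v 1) (v j) (v k) * bracket (v 1) (v j) (v 6) *
      (bracket (v 0) (v 1) (v k) * bracket (v 0) (v 1) (v 6)) < 0

lemma NormalSigns.exists_normalForm {v : Fin 7 → Fin 3 → ℝ} (hS : NormalSigns v)
    (hv : Typical v) : ∃ k ∈ logCone, total k ≠ 0 ∧ QEquivalent v (expForm k) := by
  have g01 := hv.general 0 1 6 (by decide) (by decide) (by decide)
  have g23 := hv.general 2 3 6 (by decide) (by decide) (by decide)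
  have g45 := hv.general 4 5 6 (by decide) (by decide) (by decide)
  -- the coordinates `x`, `y`, `z` vanish on the lines `AA'`, `BB'`, `CC'` and equal one at `p`
  let x : (Fin 3 → ℝ) → ℝ := fun u => bracket (v 0) (v 1) u / bracket (v 0) (v 1) (v 6)
  let y : (Fin 3 → ℝ) → ℝ := fun u => bracket (v 2) (v 3) u / bracket (v 2) (v 3) (v 6)
  let z : (Fin 3 → ℝ) → ℝ := fun u => bracket (v 4) (v 5) u / bracket (v 4) (v 5) (v 6)
  obtain ⟨M, hM⟩ : ∃ M : Matrix (Fin 3) (Fin 3) ℝ, ∀ u, M.mulVec u = ![x u, y u, z u] := by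
    refine ⟨!![x ![1, 0, 0], x ![0, 1, 0], x ![0, 0, 1]; y ![1, 0, 0], y ![0, 1, 0], y ![0, 0, 1];
      z ![1, 0, 0], z ![0, 1, 0], z ![0, 0, 1]], fun u => ?_⟩
    ext i
    fin_cases i <;>
      simp [Matrix.mulVec, dotProduct, Fin.sum_univ_three, x, y, z] <;>
      simp [bracket] <;> ring
  have hx6 : x (v 6) = 1 := div_self g01
  have hy6 : y (v 6) = 1 := div_self g23
  have hz6 : z (v 6) = 1 := div_self g45
  have hx : ∀ i, i = 0 ∨ i = 1 → x (v i) = 0 := by rintro i (rfl | rfl) <;> simp [x]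
  have hy : ∀ i, i = 2 ∨ i = 3 → y (v i) = 0 := by rintro i (rfl | rfl) <;> simp [y]
  have hz : ∀ i, i = 4 ∨ i = 5 → z (v i) = 0 := by rintro i (rfl | rfl) <;> simp [z]
  have hdiv : ∀ p q r s : ℝ, r ≠ 0 → s ≠ 0 → p * q * (r * s) < 0 → p / r * (q / s) < 0 := by
    intro p q r s hr hs h
    have : p / r * (q / s) = p * q * (r * s) / (r * s) ^ 2 := by field_simp
    rw [this]
    exact div_neg_of_neg_of_pos h (by positivity)
  have sA : ∀ i, i = 0 ∨ i = 1 → y (v i) * z (v i) < 0 := fun i hi =>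
    hdiv _ _ _ _ g23 g45 (hS.onA i hi)
  have sB : ∀ i, i = 2 ∨ i = 3 → x (v i) * z (v i) < 0 := fun i hi =>
    hdiv _ _ _ _ g01 g45 (hS.onB i hi)
  have sC : ∀ i, i = 4 ∨ i = 5 → x (v i) * y (v i) < 0 := fun i hi =>
    hdiv _ _ _ _ g01 g23 (hS.onC i hi)
  have hratio : ∀ s t : ℝ, t * s < 0 → 0 < -(s / t) ∧ t ≠ 0 ∧ s = -(t * (-(s / t))) := by
    intro s t h
    have ht : t ≠ 0 := by rintro rfl; simp at h
    refine ⟨?_, ht, by field_simp⟩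
    rw [neg_pos]
    have : s / t = t * s / t ^ 2 := by field_simp
    rw [this]
    exact div_neg_of_neg_of_pos h (by positivity)
  let α : Fin 7 → ℝ := fun i => -(z (v i) / y (v i))
  let β : Fin 7 → ℝ := fun i => -(x (v i) / z (v i))
  let γ : Fin 7 → ℝ := fun i => -(y (v i) / x (v i))
  have hα : ∀ i, i = 0 ∨ i = 1 → 0 < α i ∧ y (v i) ≠ 0 ∧ z (v i) = -(y (v i) * α i) :=
    fun i hi => hratio _ _ (sA i hi)
  have hβ : ∀ i, i = 2 ∨ i = 3 → 0 < β i ∧ z (v i) ≠ 0 ∧ x (v i) = -(z (v i) * β i) :=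
    fun i hi => hratio _ _ (by rw [mul_comm]; exact sB i hi)
  have hγ : ∀ i, i = 4 ∨ i = 5 → 0 < γ i ∧ x (v i) ≠ 0 ∧ y (v i) = -(x (v i) * γ i) :=
    fun i hi => hratio _ _ (sC i hi)
  have bABp : ∀ i j, i = 0 ∨ i = 1 → j = 2 ∨ j = 3 → M.det * bracket (v i) (v j) (v 6) =
      y (v i) * z (v j) * (1 + β j + α i * β j) := by
    intro i j hi hj
    rw [← bracket_mulVec, hM, hM, hM]
    simp only [bracket, Matrix.cons_val]
    rw [hx i hi, hy j hj, hx6, hy6, hz6, (hα i hi).2.2, (hβ j hj).2.2]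
    ring
  have bABC : ∀ i j k, i = 0 ∨ i = 1 → j = 2 ∨ j = 3 → k = 4 ∨ k = 5 →
      M.det * bracket (v i) (v j) (v k) =
      y (v i) * z (v j) * x (v k) * (1 - α i * β j * γ k) := by
    intro i j k hi hj hk
    rw [← bracket_mulVec, hM, hM, hM]
    simp only [bracket, Matrix.cons_val]
    rw [hx i hi, hy j hj, hz k hk, (hα i hi).2.2, (hβ j hj).2.2, (hγ k hk).2.2]
    ring
  -- the three lines are not concurrent, since `[A B p]` does not vanish in these coordinates
  have hdet : M.det ≠ 0 := by
    intro h0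
    have := bABp 0 2 (.inl rfl) (.inl rfl)
    rw [h0, zero_mul] at this
    have h1 := (hα 0 (.inl rfl))
    have h2 := (hβ 2 (.inl rfl))
    have h3 := mul_pos h1.1 h2.1
    refine mul_ne_zero (mul_ne_zero h1.2.1 h2.2.1) ?_ this.symm
    linarith [h2.1]
  have key : ∀ i j k, i = 0 ∨ i = 1 → j = 2 ∨ j = 3 → k = 4 ∨ k = 5 → ∃ P : ℝ, 0 < P ∧
      bracket (v i) (v j) (v k) * bracket (v i) (v j) (v 6) *
      (bracket (v 0) (v 1) (v k) * bracket (v 0) (v 1) (v 6)) = P * (1 - α i * β j * γ k) := by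
    intro i j k hi hj hk
    have e1 := bABp i j hi hj
    have e2 := bABC i j k hi hj hk
    have e3 : bracket (v 0) (v 1) (v k) = x (v k) * bracket (v 0) (v 1) (v 6) := by
      simp only [x]; field_simp
    have h1 := hα i hi
    have h2 := hβ j hj
    have h3 := hγ k hk
    have h12 := mul_pos h1.1 h2.1
    have hpos : 0 < 1 + β j + α i * β j := by linarith [h2.1]
    refine ⟨(y (v i) * z (v j) * x (v k) * bracket (v 0) (v 1) (v 6) / M.det) ^ 2
      * (1 + β j + α i * β j), ?_, ?_⟩
    · have := h1.2.1; have := h2.2.1; have := h3.2.1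
      positivity
    · have f1 : bracket (v i) (v j) (v 6) = y (v i) * z (v j) * (1 + β j + α i * β j) / M.det := by
        rw [← e1]; field_simp
      have f2 : bracket (v i) (v j) (v k) =
          y (v i) * z (v j) * x (v k) * (1 - α i * β j * γ k) / M.det := by
        rw [← e2]; field_simp
      rw [f1, f2, e3]
      field_simp
  have hlt : ∀ j k, j = 2 ∨ j = 3 → k = 4 ∨ k = 5 → α 0 * β j * γ k < 1 := by
    intro j k hj hk
    obtain ⟨P, hP, hE⟩ := key 0 j k (.inl rfl) hj hk
    have := hS.first j k hj hk
    rw [hE] at this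
    linarith [pos_of_mul_pos_right this hP.le]
  have hgt : ∀ j k, j = 2 ∨ j = 3 → k = 4 ∨ k = 5 → 1 < α 1 * β j * γ k := by
    intro j k hj hk
    obtain ⟨P, hP, hE⟩ := key 1 j k (.inr rfl) hj hk
    have := hS.second j k hj hk
    rw [hE] at this
    linarith [neg_of_mul_neg_right this hP.le]
  have hE1 := hv.qEquivalent_mulVec hdet
  have hE2 := hE1.trans (hE1.typical.qEquivalent_perm_smul
    (w := normalForm (α 0) (α 1) (β 2) (β 3) (γ 4) (γ 5)) (Equiv.refl _)
    ![(y (v 0))⁻¹, (y (v 1))⁻¹, (z (v 2))⁻¹, (z (v 3))⁻¹, (x (v 4))⁻¹, (x (v 5))⁻¹, 1] ?_ ?_)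
  · obtain ⟨k, hk, hk', h⟩ := exists_expForm_of_normalForm (hα 0 (.inl rfl)).1 (hα 1 (.inr rfl)).1
      (hβ 2 (.inl rfl)).1 (hβ 3 (.inr rfl)).1 (hγ 4 (.inl rfl)).1 (hγ 5 (.inr rfl)).1 hE2.typical
      (hlt 2 4 (.inl rfl) (.inl rfl)) (hlt 2 5 (.inl rfl) (.inr rfl))
      (hlt 3 4 (.inr rfl) (.inl rfl)) (hlt 3 5 (.inr rfl) (.inr rfl))
      (hgt 2 4 (.inl rfl) (.inl rfl)) (hgt 2 5 (.inl rfl) (.inr rfl))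
      (hgt 3 4 (.inr rfl) (.inl rfl)) (hgt 3 5 (.inr rfl) (.inr rfl))
    exact ⟨k, hk, hk', hE2.trans h⟩
  · intro i
    fin_cases i
    · exact inv_ne_zero (hα 0 (.inl rfl)).2.1
    · exact inv_ne_zero (hα 1 (.inr rfl)).2.1
    · exact inv_ne_zero (hβ 2 (.inl rfl)).2.1
    · exact inv_ne_zero (hβ 3 (.inr rfl)).2.1
    · exact inv_ne_zero (hγ 4 (.inl rfl)).2.1
    · exact inv_ne_zero (hγ 5 (.inr rfl)).2.1
    · exact one_ne_zero
  · have rA : ∀ i, i = 0 ∨ i = 1 → ![0, 1, -α i] = (y (v i))⁻¹ • M.mulVec (v i) := by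
      intro i hi
      have := (hα i hi).2.1
      rw [hM, hx i hi, (hα i hi).2.2]
      ext j; fin_cases j <;> simp <;> field_simp
    have rB : ∀ i, i = 2 ∨ i = 3 → ![-β i, 0, 1] = (z (v i))⁻¹ • M.mulVec (v i) := by
      intro i hi
      have := (hβ i hi).2.1
      rw [hM, hy i hi, (hβ i hi).2.2]
      ext j; fin_cases j <;> simp <;> field_simp
    have rC : ∀ i, i = 4 ∨ i = 5 → ![1, -γ i, 0] = (x (v i))⁻¹ • M.mulVec (v i) := by
      intro i hi
      have := (hγ i hi).2.1
      rw [hM, hz i hi, (hγ i hi).2.2]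
      ext j; fin_cases j <;> simp <;> field_simp
    intro i
    fin_cases i
    · exact rA 0 (.inl rfl)
    · exact rA 1 (.inr rfl)
    · exact rB 2 (.inl rfl)
    · exact rB 3 (.inr rfl)
    · exact rC 4 (.inl rfl)
    · exact rC 5 (.inr rfl)
    · change ![1, 1, 1] = (1 : ℝ) • M.mulVec (v 6)
      rw [hM, hx6, hy6, hz6, one_smul]

/-! ### Graphs of small degree -/

lemma exists_adj_of_connected {V : Type*} {G : SimpleGraph V} (hG : G.Connected) {s : Set V}
    {x y : V} (hx : x ∈ s) (hy : y ∉ s) : ∃ a ∈ s, ∃ b ∉ s, G.Adj a b := by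
  obtain ⟨p⟩ := hG.preconnected x y
  obtain ⟨d, -, h1, h2⟩ := p.exists_boundary_dart s hx hy
  exact ⟨d.fst, h1, d.snd, h2, d.adj⟩

/-- A finite connected graph without vertices of degree three or more has a Hamiltonian path: a
path of maximal length cannot be left. -/
lemma exists_hamiltonian_list {V : Type*} [Fintype V] {G : SimpleGraph V} (hG : G.Connected)
    (hdeg : ∀ a b c d, b ≠ c → b ≠ d → c ≠ d → G.Adj a b → G.Adj a c → ¬ G.Adj a d) :
    ∃ l : List V, l.Nodup ∧ l.IsChain G.Adj ∧ ∀ x, x ∈ l := by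
  obtain ⟨l, ⟨hnd, hch⟩, hmax⟩ : ∃ l : List V, (l.Nodup ∧ l.IsChain G.Adj) ∧
      ∀ l' : List V, l'.Nodup ∧ l'.IsChain G.Adj → l'.length ≤ l.length := by
    have hbdd : ∀ l : List V, l.Nodup ∧ l.IsChain G.Adj → l.length ≤ Fintype.card V :=
      fun l hl => hl.1.length_le_card
    by_contra! hcon
    have : ∀ n : ℕ, ∃ l : List V, (l.Nodup ∧ l.IsChain G.Adj) ∧ n ≤ l.length := by
      intro n
      induction n with
      | zero => exact ⟨[], by simp, by simp⟩
      | succ n ih =>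
        obtain ⟨l, hl, hn⟩ := ih
        obtain ⟨l', hl', h⟩ := hcon l hl
        exact ⟨l', hl', by omega⟩
    obtain ⟨l, hl, h⟩ := this (Fintype.card V + 1)
    have := hbdd l hl
    omega
  refine ⟨l, hnd, hch, ?_⟩
  by_contra! hx
  obtain ⟨x, hx⟩ := hx
  have hne : l ≠ [] := by
    rintro rfl
    simpa using hmax [x] (by simp)
  obtain ⟨x₀, hx₀⟩ := List.exists_mem_of_ne_nil l hne
  obtain ⟨y, hy, z, hz, hyz⟩ := exists_adj_of_connected hG (s := {x | x ∈ l}) hx₀ hx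
  simp only [Set.mem_ofPred_eq] at hy hz
  obtain ⟨s, t, rfl⟩ := List.append_of_mem hy
  rcases List.eq_nil_or_concat s with rfl | ⟨s, a, rfl⟩
  · have := hmax (z :: y :: t) ⟨by simpa using ⟨by simpa using hz, by simpa using hnd⟩, by
      simpa using ⟨hyz.symm, hch⟩⟩
    simp at this
  rcases t with _ | ⟨b, t⟩
  · have := hmax ((s ++ [a]) ++ [y] ++ [z]) ⟨by
      rw [List.nodup_append]
      refine ⟨by simpa using hnd, by simp, ?_⟩
      rintro u hu w hw rfl
      simp only [List.mem_singleton] at hw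
      subst hw
      exact hz (by simpa using hu), by
      rw [List.isChain_append]
      refine ⟨by simpa using hch, by simp, ?_⟩
      simpa using hyz⟩
    simp at this
  · simp only [List.concat_eq_append, List.append_assoc, List.cons_append, List.nil_append] at *
    have hch' : List.IsChain G.Adj (a :: y :: b :: t) := (List.isChain_append.1 hch).2.1
    simp only [List.isChain_cons_cons] at hch'
    have hnd' : (a :: y :: b :: t).Nodup := (List.nodup_append.1 hnd).2.1
    simp only [List.nodup_cons, List.mem_cons, not_or] at hnd'
    simp only [List.mem_append, List.mem_cons, not_or] at hz
    exact hdeg y a b z hnd'.1.2.1 (Ne.symm hz.2.1) (Ne.symm hz.2.2.2.1) hch'.1.symm hch'.2.1 hyz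

/-- A graph with few components has a vertex with two neighbours, since otherwise no component has
more than two vertices. -/
lemma exists_two_neighbors {V : Type*} [Fintype V] {G : SimpleGraph V} {n : ℕ}
    (hn : Nat.card G.ConnectedComponent = n) (hV : 2 * n < Fintype.card V) :
    ∃ a b c, b ≠ c ∧ G.Adj a b ∧ G.Adj a c := by
  classical
  by_contra! hcon
  have : Fintype G.ConnectedComponent := Fintype.ofFinite _
  rw [Nat.card_eq_fintype_card] at hn
  obtain ⟨C, hC⟩ := Fintype.exists_lt_card_fiber_of_mul_lt_card G.connectedComponentMk
    (n := 2) (by rw [hn]; omega)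
  obtain ⟨x, y, z, hx, hy, hz, hxy, hxz, hyz⟩ := Finset.two_lt_card_iff.1 hC
  simp only [Finset.mem_filter, Finset.mem_univ, true_and] at hx hy hz
  have key : ∀ u, G.connectedComponentMk u = C → u ≠ x → G.Adj x u := by
    intro u hu hux
    have hr : G.Reachable x u := SimpleGraph.ConnectedComponent.exact (hx.trans hu.symm)
    obtain ⟨p⟩ := hr
    by_contra hxu
    obtain ⟨d, -, h1, h2⟩ := p.exists_boundary_dart {w | w = x ∨ G.Adj x w} (Or.inl rfl)
      (by simp [hux, hxu])
    simp only [Set.mem_ofPred_eq, not_or] at h1 h2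
    rcases h1 with h1 | h1
    · exact h2.2 (h1 ▸ d.adj)
    · exact hcon d.fst x d.snd (Ne.symm h2.1) h1.symm d.adj
  exact hcon x y z hyz (key y hy hxy.symm) (key z hz hxz.symm)

/-! ### Hexagons -/

section

variable {ι : Type*} {v : ι → Fin 3 → ℝ}

lemma bracketGraph_adj_mul_pos {i j : ι} (h : (bracketGraph v).Adj i j) {r s r' s' : ι}
    (hrs : r ≠ s) (hri : r ≠ i) (hrj : r ≠ j) (hsi : s ≠ i) (hsj : s ≠ j)
    (hrs' : r' ≠ s') (hri' : r' ≠ i) (hrj' : r' ≠ j) (hsi' : s' ≠ i) (hsj' : s' ≠ j) :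
    0 < (bracket (v i) (v r) (v s) * bracket (v j) (v r) (v s)) *
      (bracket (v i) (v r') (v s') * bracket (v j) (v r') (v s')) := by
  rcases h with ⟨-, h | h⟩
  · exact mul_pos (h r s hrs hri hrj hsi hsj) (h r' s' hrs' hri' hrj' hsi' hsj')
  · exact mul_pos_of_neg_of_neg (h r s hrs hri hrj hsi hsj) (h r' s' hrs' hri' hrj' hsi' hsj')

/-- In a configuration of at least five points, no point is adjacent to three others. -/
lemma not_three_neighbors {a b c d e : ι} (hab : (bracketGraph v).Adj a b)
    (hac : (bracketGraph v).Adj a c) (had : (bracketGraph v).Adj a d) (hbc : b ≠ c) (hbd : b ≠ d)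
    (hcd : c ≠ d) (hea : e ≠ a) (heb : e ≠ b) (hec : e ≠ c) (hed : e ≠ d) : False := by
  have h1 := bracketGraph_adj_mul_pos hab hed.symm had.1.symm hbd.symm hea heb
    hec.symm hac.1.symm hbc.symm hea heb
  have h2 := bracketGraph_adj_mul_pos hac hed.symm had.1.symm hcd.symm hea hec
    heb.symm hab.1.symm hbc hea hec
  have h3 := bracketGraph_adj_mul_pos had hec.symm hac.1.symm hcd hea hed
    heb.symm hab.1.symm hbd hea hed
  rw [bracket_swap_left (v b) (v c)] at h2
  rw [bracket_swap_left (v c) (v d), bracket_swap_left (v b) (v d)] at h3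
  have h4 := mul_pos (mul_pos h1 h2) h3
  nlinarith [sq_nonneg (bracket (v a) (v d) (v e) * bracket (v a) (v c) (v e) *
    bracket (v a) (v b) (v e) * bracket (v b) (v d) (v e) * bracket (v b) (v c) (v e) *
    bracket (v c) (v d) (v e))]

end

lemma mul_pos_trans {a b c : ℝ} (h1 : 0 < a * b) (h2 : 0 < b * c) : 0 < a * c := by
  have h3 := mul_pos h1 h2
  have h4 : 0 < b * b := mul_self_pos.2 (by rintro rfl; simp at h1)
  have : a * b * (b * c) = a * c * (b * b) := by ring
  rw [this] at h3
  exact pos_of_mul_pos_left h3 h4.le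

/-- If each of the vectors `W 0, …, W 5` can replace the next one in all brackets without changing
signs, then all brackets of increasing triples have the same sign. -/
lemma bracket_mul_bracket_pos {W : ℕ → Fin 3 → ℝ}
    (H : ∀ i r s, i + 1 < 6 → r < 6 → s < 6 → r ≠ s → r ≠ i → r ≠ i + 1 → s ≠ i → s ≠ i + 1 →
      0 < bracket (W i) (W r) (W s) * bracket (W (i + 1)) (W r) (W s)) {i j k : ℕ}
    (hij : i < j) (hjk : j < k) (hk : k < 6) :
    0 < bracket (W 0) (W 1) (W 2) * bracket (W i) (W j) (W k) := by
  have h0 : ∀ k, 2 ≤ k → k < 6 →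
      0 < bracket (W 0) (W 1) (W 2) * bracket (W 0) (W 1) (W k) := by
    intro k hk
    induction k, hk using Nat.le_induction with
    | base =>
      intro _
      have h2 := H 2 0 1 (by omega) (by omega) (by omega) (by omega) (by omega) (by omega)
        (by omega) (by omega)
      rw [mul_self_pos]
      rintro h
      rw [bracket_rotate, bracket_rotate] at h2
      simp [h] at h2
    | succ k hk ih =>
      intro hk'
      refine mul_pos_trans (ih (by omega)) ?_
      have := H k 0 1 (by omega) (by omega) (by omega) (by omega) (by omega) (by omega)
        (by omega) (by omega)
      rwa [← bracket_rotate (W k), ← bracket_rotate (W (k + 1))] at this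
  have h1 : ∀ j, 1 ≤ j → ∀ k, j < k → k < 6 →
      0 < bracket (W 0) (W 1) (W 2) * bracket (W 0) (W j) (W k) := by
    intro j hj
    induction j, hj using Nat.le_induction with
    | base => exact fun k hk => h0 k (by omega)
    | succ j hj ih =>
      intro k hk hk'
      refine mul_pos_trans (ih k (by omega) hk') ?_
      have := H j k 0 (by omega) (by omega) (by omega) (by omega) (by omega) (by omega)
        (by omega) (by omega)
      rwa [bracket_rotate (W 0) (W j), bracket_rotate (W 0) (W (j + 1))] at this
  induction i generalizing j k with
  | zero => exact h1 j (by omega) k hjk hk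
  | succ i ih =>
    exact mul_pos_trans (ih (by omega) hjk hk) (H i j k (by omega) (by omega) (by omega)
      (by omega) (by omega) (by omega) (by omega) (by omega))

/-- If the adjacency graph of a simple configuration minus a point `m` is connected, then the six
other points form a hexagon: in suitable order and with suitable signs, all the brackets of their
representing vectors are positive. -/
lemma exists_hexagon {v : Fin 7 → Fin 3 → ℝ} {m : Fin 7}
    (hm : derivedCount v m = 1) : ∃ (τ : Equiv.Perm (Fin 7)) (ε : Fin 7 → ℝ), (∀ i, ε i ≠ 0) ∧
      τ 6 = m ∧ ∀ i j k, i < j → j < k → k < 6 →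
        0 < bracket (ε i • v (τ i)) (ε j • v (τ j)) (ε k • v (τ k)) := by
  set G := bracketGraph (fun i : {i : Fin 7 // i ≠ m} => v i) with hGdef
  have hcard : Fintype.card {i : Fin 7 // i ≠ m} = 6 := by
    rw [Fintype.card_subtype_compl, Fintype.card_fin, Fintype.card_subtype_eq]
  have hG : G.Connected := by
    obtain ⟨hs, hne⟩ := Nat.card_eq_one_iff_unique.1 hm
    exact (SimpleGraph.connected_iff _).2
      ⟨fun x y => SimpleGraph.ConnectedComponent.exact (Subsingleton.elim _ _),
        Fintype.card_pos_iff.1 (by omega)⟩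
  obtain ⟨l, hnd, hch, hall⟩ := exists_hamiltonian_list hG (by
    intro a b c d hbc hbd hcd hab hac had
    obtain ⟨e, he⟩ : ∃ e, e ∉ ({a, b, c, d} : Finset {i : Fin 7 // i ≠ m}) := by
      by_contra! h
      have h1 := Finset.card_le_card (fun x _ => h x :
        Finset.univ ⊆ ({a, b, c, d} : Finset {i : Fin 7 // i ≠ m}))
      have h2 := Finset.card_le_four (a := a) (b := b) (c := c) (d := d)
      rw [Finset.card_univ, hcard] at h1
      omega
    simp only [Finset.mem_insert, Finset.mem_singleton, not_or] at he
    exact not_three_neighbors hab hac had hbc hbd hcd he.1 he.2.1 he.2.2.1 he.2.2.2)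
  have hlen : l.length = 6 := by
    rw [← hcard]
    refine le_antisymm hnd.length_le_card ?_
    classical
    have : (Finset.univ : Finset {i : Fin 7 // i ≠ m}) ⊆ l.toFinset := fun x _ => by simp [hall]
    exact (Finset.card_le_card this).trans l.toFinset_card_le
  -- the order along the Hamiltonian path, with `m` at the end
  let q : ℕ → Fin 7 := fun n => if h : n < l.length then (l[n] : Fin 7) else m
  have hq : ∀ n (h : n < l.length), q n = l[n] := fun n h => by simp [q, h]
  have hq6 : ∀ n, ¬ n < l.length → q n = m := fun n h => by simp [q, h]
  have hqne : ∀ n, n < 6 → q n ≠ m := fun n h => by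
    rw [hq n (by omega)]
    exact (l[n]).2
  have hqinj : ∀ a b, a < 6 → b < 6 → q a = q b → a = b := by
    intro a b ha hb hab
    rw [hq a (by omega), hq b (by omega)] at hab
    exact (hnd.getElem_inj_iff).1 (Subtype.ext hab)
  have hτinj : Function.Injective (fun i : Fin 7 => q i) := by
    intro a b hab
    have ha := a.2
    have hb := b.2
    simp only at hab
    by_cases ha6 : a.1 < 6 <;> by_cases hb6 : b.1 < 6
    · exact Fin.ext (hqinj _ _ ha6 hb6 hab)
    · rw [hq6 b (by omega)] at hab
      exact absurd hab (hqne a ha6)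
    · rw [hq6 a (by omega)] at hab
      exact absurd hab.symm (hqne b hb6)
    · exact Fin.ext (by omega)
  let τ : Equiv.Perm (Fin 7) := Equiv.ofBijective _ (Finite.injective_iff_bijective.1 hτinj)
  have hτ : ∀ i, τ i = q i := fun i => rfl
  -- the sign comparing consecutive vectors of the path
  have hc : ∀ i, ∃ c : ℝ, c ≠ 0 ∧ (i + 1 < 6 → ∀ r s, r < 6 → s < 6 → r ≠ s → r ≠ i → r ≠ i + 1 →
      s ≠ i → s ≠ i + 1 → 0 < c * (bracket (v (q i)) (v (q r)) (v (q s)) *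
        bracket (v (q (i + 1))) (v (q r)) (v (q s)))) := by
    intro i
    by_cases hi : i + 1 < 6
    · have hadj : G.Adj l[i] l[i + 1] := List.isChain_iff_getElem.1 hch i (by omega)
      have hcond : ∀ r s, r < 6 → s < 6 → r ≠ s → r ≠ i → r ≠ i + 1 → s ≠ i → s ≠ i + 1 →
          ((∀ r s : {i : Fin 7 // i ≠ m}, r ≠ s → r ≠ l[i] → r ≠ l[i + 1] → s ≠ l[i] →
            s ≠ l[i + 1] → 0 < bracket (v l[i]) (v r) (v s) * bracket (v l[i + 1]) (v r) (v s)) →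
          0 < bracket (v (q i)) (v (q r)) (v (q s)) *
            bracket (v (q (i + 1))) (v (q r)) (v (q s))) ∧
          ((∀ r s : {i : Fin 7 // i ≠ m}, r ≠ s → r ≠ l[i] → r ≠ l[i + 1] → s ≠ l[i] →
            s ≠ l[i + 1] → bracket (v l[i]) (v r) (v s) * bracket (v l[i + 1]) (v r) (v s) < 0) →
          bracket (v (q i)) (v (q r)) (v (q s)) *
            bracket (v (q (i + 1))) (v (q r)) (v (q s)) < 0) := by
        intro r s hr hs hrs hri hri' hsi hsi'
        rw [hq i (by omega), hq (i + 1) (by omega), hq r (by omega), hq s (by omega)]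
        have hne : ∀ a b (ha : a < l.length) (hb : b < l.length), a ≠ b → l[a] ≠ l[b] :=
          fun a b ha hb hab h => hab ((hnd.getElem_inj_iff).1 h)
        exact ⟨fun h => h _ _ (hne _ _ _ _ hrs) (hne _ _ _ _ hri) (hne _ _ _ _ hri')
          (hne _ _ _ _ hsi) (hne _ _ _ _ hsi'), fun h => h _ _ (hne _ _ _ _ hrs)
          (hne _ _ _ _ hri) (hne _ _ _ _ hri') (hne _ _ _ _ hsi) (hne _ _ _ _ hsi')⟩
      rcases hadj.2 with h | h
      · refine ⟨1, one_ne_zero, fun _ r s h1 h2 h3 h4 h5 h6 h7 => ?_⟩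
        rw [one_mul]
        exact (hcond r s h1 h2 h3 h4 h5 h6 h7).1 h
      · refine ⟨-1, by simp, fun _ r s h1 h2 h3 h4 h5 h6 h7 => ?_⟩
        have := (hcond r s h1 h2 h3 h4 h5 h6 h7).2 h
        linarith
    · exact ⟨1, one_ne_zero, fun h => absurd h hi⟩
  choose c hc0 hc using hc
  let e : ℕ → ℝ := fun n => ∏ t ∈ Finset.range n, c t
  have he0 : ∀ n, e n ≠ 0 := fun n => Finset.prod_ne_zero_iff.2 fun t _ => hc0 t
  let W : ℕ → Fin 3 → ℝ := fun n => e n • v (q n)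
  have hW : ∀ i r s, i + 1 < 6 → r < 6 → s < 6 → r ≠ s → r ≠ i → r ≠ i + 1 → s ≠ i →
      s ≠ i + 1 → 0 < bracket (W i) (W r) (W s) * bracket (W (i + 1)) (W r) (W s) := by
    intro i r s hi hr hs h1 h2 h3 h4 h5
    have := hc i hi r s hr hs h1 h2 h3 h4 h5
    have h6 : e (i + 1) = e i * c i := Finset.prod_range_succ _ _
    simp only [W]
    rw [bracket_smul, bracket_smul, h6]
    have h7 := mul_pos (a := (e i * e r * e s) ^ 2)
      (by have := he0 i; have := he0 r; have := he0 s; positivity) this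
    linarith
  have hpos := fun i j k => bracket_mul_bracket_pos hW (i := i) (j := j) (k := k)
  have hne : bracket (W 0) (W 1) (W 2) ≠ 0 := by
    have := hpos 0 1 2 (by omega) (by omega) (by omega)
    exact fun h => by simp [h] at this
  -- a common sign makes the first bracket, and hence all of them, positive
  refine ⟨τ, fun i => bracket (W 0) (W 1) (W 2) * e i, fun i => mul_ne_zero hne (he0 _), ?_, ?_⟩
  · rw [hτ]
    exact hq6 _ (by simp [hlen])
  · intro i j k hij hjk hk
    have := hpos i j k hij hjk hk
    rw [hτ, hτ, hτ, mul_smul, mul_smul, mul_smul, bracket_smul]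
    have h2 : 0 < bracket (W 0) (W 1) (W 2) ^ 2 := by positivity
    have h3 := mul_pos h2 this
    calc 0 < _ := h3
      _ = _ := by simp only [W]; ring

/-- The derived counts depend on the points of the configuration only. -/
lemma derivedCount_perm_smul {v w : Fin 7 → Fin 3 → ℝ} (hv : General v) (hw : General w)
    (τ : Equiv.Perm (Fin 7)) (ε : Fin 7 → ℝ) (h : ∀ i, w i = ε i • v (τ i)) (m : Fin 7) :
    derivedCount w m = derivedCount v (τ m) := by
  have hv0 := hv.ne_zero (by simp)
  have hw0 := hw.ne_zero (by simp)
  rw [← componentCount_toConfig_diff ⟨w, hw⟩ hw0, ← componentCount_toConfig_diff ⟨v, hv⟩ hv0,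
    toConfig_perm_smul hv hw τ ε h]
  congr 2
  refine congrArg _ ?_
  exact (Projectivization.mk_eq_mk_iff' ℝ _ _ _ _).2 ⟨ε m, (h m).symm⟩

/-! ### The finite search over bracket signs -/

/-- `χ` records the bracket signs of `w`: on distinct indices, `true` stands for a positive
bracket. -/
def Represents (χ : Fin 7 → Fin 7 → Fin 7 → Bool) (w : Fin 7 → Fin 3 → ℝ) : Prop :=
  ∀ i j k, i ≠ j → j ≠ k → i ≠ k → (χ i j k = true ↔ 0 < bracket (w i) (w j) (w k))

/-- The list of all indices, written out for fast evaluation. -/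
def vertices : List (Fin 7) := [0, 1, 2, 3, 4, 5, 6]

/-- `f r s` holds whenever `r` stands before `s` in the list. -/
def pairAll (f : Fin 7 → Fin 7 → Bool) : List (Fin 7) → Bool
  | [] => true
  | a :: l => l.all (f a) && pairAll f l

/-- The indices different from `m`, `i` and `j`. -/
def others (m i j : Fin 7) : List (Fin 7) :=
  vertices.filter fun r => !(r == m) && (!(r == i) && !(r == j))

/-- Adjacency of `i` and `j` in the configuration without its `m`-th point, in terms of signs. -/
def adjB (χ : Fin 7 → Fin 7 → Fin 7 → Bool) (m i j : Fin 7) : Bool :=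
  !(i == j) && (pairAll (fun r s => χ i r s == χ j r s) (others m i j) ||
    pairAll (fun r s => !(χ i r s == χ j r s)) (others m i j))

/-- Without its `m`-th point, the configuration has a point with two neighbours. -/
def hasTwoNeighbors (χ : Fin 7 → Fin 7 → Fin 7 → Bool) (m : Fin 7) : Bool :=
  vertices.any fun a => !(a == m) && vertices.any fun b => !(b == m) && (adjB χ m a b &&
    vertices.any fun c => !(c == m) && (!(b == c) && adjB χ m a c))

/-- `r` holds between consecutive members of the list. -/
def chainB (r : Fin 7 → Fin 7 → Bool) : List (Fin 7) → Bool
  | a :: b :: l => r a b && chainB r (b :: l)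
  | _ => true

/-- After removal of some point of the hexagon `(0, …, 5)`, there is a Hamiltonian path that starts
at the point `6` and follows the cyclic order of the five other points. -/
def hasHexagon (χ : Fin 7 → Fin 7 → Fin 7 → Bool) : Bool :=
  [(0, [1, 2, 3, 4, 5]), (1, [2, 3, 4, 5, 0]), (2, [3, 4, 5, 0, 1]), (3, [4, 5, 0, 1, 2]),
    (4, [5, 0, 1, 2, 3]), (5, [0, 1, 2, 3, 4])].any fun x => [0, 1, 2, 3, 4].any fun k =>
      chainB (adjB χ x.1) (6 :: x.2.rotate k)

/-- The sign of a product of four factors: `true` stands for positive. -/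
def posB (p q r s : Bool) : Bool := (p == q) == (r == s)

/-- The sign conditions `NormalSigns` after relabelling by `τ`. -/
def normalSignsB (χ : Fin 7 → Fin 7 → Fin 7 → Bool) (τ : Fin 7 → Fin 7) : Bool :=
  let ψ := fun i j k => χ (τ i) (τ j) (τ k)
  ([0, 1].all fun i => !posB (ψ 2 3 i) (ψ 4 5 i) (ψ 2 3 6) (ψ 4 5 6)) &&
  ([2, 3].all fun j => !posB (ψ 0 1 j) (ψ 4 5 j) (ψ 0 1 6) (ψ 4 5 6)) &&
  ([4, 5].all fun k => !posB (ψ 0 1 k) (ψ 2 3 k) (ψ 0 1 6) (ψ 2 3 6)) &&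
  ([2, 3].all fun j => [4, 5].all fun k => posB (ψ 0 j k) (ψ 0 j 6) (ψ 0 1 k) (ψ 0 1 6)) &&
  ([2, 3].all fun j => [4, 5].all fun k => !posB (ψ 1 j k) (ψ 1 j 6) (ψ 0 1 k) (ψ 0 1 6))

/-- The possible positions of `(A, A', B, B', C, C')` on the hexagon `(0, …, 5)`. -/
def labellings : List (Fin 7 → Fin 7) :=
  [![0, 3, 1, 2, 4, 5, 6], ![0, 3, 4, 5, 1, 2, 6], ![1, 4, 2, 3, 5, 0, 6], ![1, 4, 5, 0, 2, 3, 6],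
   ![2, 5, 3, 4, 0, 1, 6], ![2, 5, 0, 1, 3, 4, 6]]

/-- The sequence of signs changes at most once. -/
def changesOnce (a b c d e : Bool) : Bool :=
  bif a == b then (bif b == c then (d == c || d == e) else c == d && d == e)
    else b == c && (c == d && d == e)

/-- The bracket signs of a positive hexagon `(0, …, 5)` and a point `6`, where `s` is the table of
the signs of the brackets `[i j 6]`. -/
def hexagonSigns (s : List (List Bool)) (i j k : Fin 7) : Bool :=
  bif k.1.beq 6 then (s.getD i.1 []).getD j.1 false else
  bif j.1.beq 6 then (s.getD k.1 []).getD i.1 false else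
  bif i.1.beq 6 then (s.getD j.1 []).getD k.1 false else
  bif i.1.blt j.1 then j.1.blt k.1 || k.1.blt i.1 else j.1.blt k.1 && k.1.blt i.1

/-- The antisymmetric table with the given entries above the diagonal. -/
def signTable (a01 a02 a03 a04 a05 a12 a13 a14 a15 a23 a24 a25 a34 a35 a45 : Bool) :
    List (List Bool) :=
  [[false, a01, a02, a03, a04, a05], [!a01, false, a12, a13, a14, a15],
    [!a02, !a12, false, a23, a24, a25], [!a03, !a13, !a23, false, a34, a35],
    [!a04, !a14, !a24, !a34, false, a45], [!a05, !a15, !a25, !a35, !a45, false]]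

/-- If no six points including the point `6` form a hexagon, and each of these sextuples has a point
with two neighbours, then the normal sign conditions hold in some labelling. -/
def searchB (χ : Fin 7 → Fin 7 → Fin 7 → Bool) : Bool :=
  (labellings.any fun τ => normalSignsB χ τ) || (hasHexagon χ ||
    !([0, 1, 2, 3, 4, 5].all fun m => hasTwoNeighbors χ m))

set_option maxRecDepth 100000 in
/-- There are only 74 sign patterns in which, around each vertex of the hexagon, the side on which
the point `6` lies changes at most once; the search inspects each of them. -/
lemma searchB_hexagonSigns : ∀ a01 a02 a03 a04 a05 : Bool,
    changesOnce a01 a02 a03 a04 a05 = true →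
    ∀ a12 a13 a14 a15 : Bool, changesOnce a12 a13 a14 a15 (!a01) = true →
    ∀ a23 a24 a25 : Bool, changesOnce a23 a24 a25 (!a02) (!a12) = true →
    ∀ a34 a35 : Bool, changesOnce a34 a35 (!a03) (!a13) (!a23) = true →
    ∀ a45 : Bool, changesOnce a45 (!a04) (!a14) (!a24) (!a34) = true →
    changesOnce (!a05) (!a15) (!a25) (!a35) (!a45) = true →
    searchB (hexagonSigns
      (signTable a01 a02 a03 a04 a05 a12 a13 a14 a15 a23 a24 a25 a34 a35 a45)) = true := by
  decide +kernel

/-- The search for an antisymmetric sign function `s` in place of the entries of a table. -/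
lemma exists_table_searchB {s : Fin 7 → Fin 7 → Bool} (hs : ∀ i j, i < j → j < 6 → (!s i j) = s j i)
    (h0 : changesOnce (s 0 1) (s 0 2) (s 0 3) (s 0 4) (s 0 5) = true)
    (h1 : changesOnce (s 1 2) (s 1 3) (s 1 4) (s 1 5) (s 1 0) = true)
    (h2 : changesOnce (s 2 3) (s 2 4) (s 2 5) (s 2 0) (s 2 1) = true)
    (h3 : changesOnce (s 3 4) (s 3 5) (s 3 0) (s 3 1) (s 3 2) = true)
    (h4 : changesOnce (s 4 5) (s 4 0) (s 4 1) (s 4 2) (s 4 3) = true)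
    (h5 : changesOnce (s 5 0) (s 5 1) (s 5 2) (s 5 3) (s 5 4) = true) :
    ∃ T : List (List Bool), (∀ i j : Fin 7, i ≠ j → i ≠ 6 → j ≠ 6 →
      (T.getD i.1 []).getD j.1 false = s i j) ∧ searchB (hexagonSigns T) = true := by
  simp only [← hs 0 1 (by decide) (by decide), ← hs 0 2 (by decide) (by decide),
    ← hs 0 3 (by decide) (by decide), ← hs 0 4 (by decide) (by decide),
    ← hs 0 5 (by decide) (by decide), ← hs 1 2 (by decide) (by decide),
    ← hs 1 3 (by decide) (by decide), ← hs 1 4 (by decide) (by decide),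
    ← hs 1 5 (by decide) (by decide), ← hs 2 3 (by decide) (by decide),
    ← hs 2 4 (by decide) (by decide), ← hs 2 5 (by decide) (by decide),
    ← hs 3 4 (by decide) (by decide), ← hs 3 5 (by decide) (by decide),
    ← hs 4 5 (by decide) (by decide)] at h0 h1 h2 h3 h4 h5
  refine ⟨_, ?_, searchB_hexagonSigns _ _ _ _ _ h0 _ _ _ _ h1 _ _ _ h2 _ _ h3 _ h4 h5⟩
  intro i j hij hi hj
  fin_cases i <;> fin_cases j <;> first
    | exact absurd rfl hij
    | exact absurd rfl hi
    | exact absurd rfl hj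
    | rfl
    | exact hs _ _ (by decide) (by decide)

lemma injective_of_mem_labellings {τ : Fin 7 → Fin 7} (hτ : τ ∈ labellings) :
    Function.Injective τ := by
  simp only [labellings, List.mem_cons, List.not_mem_nil, or_false] at hτ
  rcases hτ with rfl | rfl | rfl | rfl | rfl | rfl <;> decide

lemma pairAll_iff (f : Fin 7 → Fin 7 → Bool) (l : List (Fin 7)) :
    pairAll f l = true ↔ l.Pairwise fun r s => f r s = true := by
  induction l with
  | nil => simp [pairAll]
  | cons a l ih => simp [pairAll, ih]

lemma chainB_iff (r : Fin 7 → Fin 7 → Bool) (l : List (Fin 7)) :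
    chainB r l = true ↔ l.IsChain fun a b => r a b = true := by
  induction l with
  | nil => simp [chainB]
  | cons a l ih => cases l with
    | nil => simp [chainB]
    | cons b l => simp [chainB, ih]

lemma mem_others {m i j r : Fin 7} : r ∈ others m i j ↔ r ≠ m ∧ r ≠ i ∧ r ≠ j := by
  have : r ∈ vertices := by revert r; decide
  simp [others, this]

lemma beq_eq_true_iff_of_pos {p q : Bool} {x y : ℝ} (hx : x ≠ 0) (hy : y ≠ 0)
    (hp : p = true ↔ 0 < x) (hq : q = true ↔ 0 < y) : ((p == q) = true ↔ 0 < x * y) := by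
  rcases lt_or_gt_of_ne hx with h1 | h1 <;> rcases lt_or_gt_of_ne hy with h2 | h2
  · have := mul_pos_of_neg_of_neg h1 h2
    cases p <;> cases q <;> simp_all [h1.not_gt, h2.not_gt]
  · have := mul_neg_of_neg_of_pos h1 h2
    cases p <;> cases q <;> simp_all [h1.not_gt, this.not_gt]
  · have := mul_neg_of_pos_of_neg h1 h2
    cases p <;> cases q <;> simp_all [h2.not_gt, this.not_gt]
  · have := mul_pos h1 h2
    cases p <;> cases q <;> simp_all

lemma posB_eq_true_iff {p q r s : Bool} {x y z t : ℝ} (hx : x ≠ 0) (hy : y ≠ 0) (hz : z ≠ 0)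
    (ht : t ≠ 0) (hp : p = true ↔ 0 < x) (hq : q = true ↔ 0 < y) (hr : r = true ↔ 0 < z)
    (hs : s = true ↔ 0 < t) : posB p q r s = true ↔ 0 < x * y * (z * t) :=
  beq_eq_true_iff_of_pos (mul_ne_zero hx hy) (mul_ne_zero hz ht)
    (beq_eq_true_iff_of_pos hx hy hp hq) (beq_eq_true_iff_of_pos hz ht hr hs)

section

variable {χ : Fin 7 → Fin 7 → Fin 7 → Bool} {w : Fin 7 → Fin 3 → ℝ}

lemma adjB_iff (hχ : Represents χ w) (hw : General w) {m i j : Fin 7} (hi : i ≠ m) (hj : j ≠ m) :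
    adjB χ m i j = true ↔
      (bracketGraph fun x : {x : Fin 7 // x ≠ m} => w x).Adj ⟨i, hi⟩ ⟨j, hj⟩ := by
  have hnd : (others m i j).Nodup := List.Nodup.filter _ (by decide)
  have hbeq : ∀ r ∈ others m i j, ∀ s ∈ others m i j, i ≠ j → r ≠ s →
      ((χ i r s == χ j r s) = true ↔
        0 < bracket (w i) (w r) (w s) * bracket (w j) (w r) (w s)) := by
    intro r hr s hs _ hrs
    rw [mem_others] at hr hs
    exact beq_eq_true_iff_of_pos (hw _ _ _ hr.2.1.symm hrs hs.2.1.symm)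
      (hw _ _ _ hr.2.2.symm hrs hs.2.2.symm) (hχ _ _ _ hr.2.1.symm hrs hs.2.1.symm)
      (hχ _ _ _ hr.2.2.symm hrs hs.2.2.symm)
  have hne : ∀ r ∈ others m i j, ∀ s ∈ others m i j, r ≠ s →
      bracket (w i) (w r) (w s) * bracket (w j) (w r) (w s) ≠ 0 := by
    intro r hr s hs hrs
    rw [mem_others] at hr hs
    exact mul_ne_zero (hw _ _ _ hr.2.1.symm hrs hs.2.1.symm)
      (hw _ _ _ hr.2.2.symm hrs hs.2.2.symm)
  have hsymm : ∀ r s, bracket (w i) (w s) (w r) * bracket (w j) (w s) (w r) =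
      bracket (w i) (w r) (w s) * bracket (w j) (w r) (w s) := by
    intro r s
    rw [bracket_swap_right (w i) (w r), bracket_swap_right (w j) (w r)]; ring
  have h1 : i ≠ j → (pairAll (fun r s => χ i r s == χ j r s) (others m i j) = true ↔
      ∀ r ∈ others m i j, ∀ s ∈ others m i j, r ≠ s →
        0 < bracket (w i) (w r) (w s) * bracket (w j) (w r) (w s)) := by
    intro hij
    rw [pairAll_iff]
    constructor
    · intro h
      have h' : (others m i j).Pairwise fun r s =>
          0 < bracket (w i) (w r) (w s) * bracket (w j) (w r) (w s) :=
        (h.and hnd).imp_of_mem fun hr hs h => (hbeq _ hr _ hs hij h.2).1 h.1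
      have hs : Std.Symm fun r s =>
          0 < bracket (w i) (w r) (w s) * bracket (w j) (w r) (w s) :=
        ⟨fun r s h => by rw [hsymm]; exact h⟩
      exact fun r hr s hs hrs => h'.forall hr hs hrs
    · intro h
      exact hnd.imp_of_mem fun hr hs hrs => (hbeq _ hr _ hs hij hrs).2 (h _ hr _ hs hrs)
  have h2 : i ≠ j → (pairAll (fun r s => !(χ i r s == χ j r s)) (others m i j) = true ↔
      ∀ r ∈ others m i j, ∀ s ∈ others m i j, r ≠ s →
        bracket (w i) (w r) (w s) * bracket (w j) (w r) (w s) < 0) := by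
    intro hij
    rw [pairAll_iff]
    constructor
    · intro h
      have h' : (others m i j).Pairwise fun r s =>
          bracket (w i) (w r) (w s) * bracket (w j) (w r) (w s) < 0 :=
        (h.and hnd).imp_of_mem fun hr hs h => by
          have h3 := mt (hbeq _ hr _ hs hij h.2).2 (by simpa using h.1)
          exact lt_of_le_of_ne (not_lt.1 h3) (hne _ hr _ hs h.2)
      have hs : Std.Symm fun r s =>
          bracket (w i) (w r) (w s) * bracket (w j) (w r) (w s) < 0 :=
        ⟨fun r s h => by rw [hsymm]; exact h⟩
      exact fun r hr s hs hrs => h'.forall hr hs hrs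
    · intro h
      refine hnd.imp_of_mem fun hr hs hrs => ?_
      have := mt (hbeq _ hr _ hs hij hrs).1 (h _ hr _ hs hrs).not_gt
      simpa using this
  have h3 : ∀ p : Fin 7 → Fin 7 → Prop, (∀ r ∈ others m i j, ∀ s ∈ others m i j, r ≠ s → p r s) ↔
      ∀ r s : {x : Fin 7 // x ≠ m}, r ≠ s → r ≠ ⟨i, hi⟩ → r ≠ ⟨j, hj⟩ → s ≠ ⟨i, hi⟩ →
        s ≠ ⟨j, hj⟩ → p r s := by
    intro p
    constructor
    · rintro h ⟨r, hr⟩ ⟨s, hs⟩ hrs hri hrj hsi hsj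
      simp only [ne_eq, Subtype.mk.injEq] at hrs hri hrj hsi hsj
      exact h r (mem_others.2 ⟨hr, hri, hrj⟩) s (mem_others.2 ⟨hs, hsi, hsj⟩) hrs
    · intro h r hr s hs hrs
      rw [mem_others] at hr hs
      exact h ⟨r, hr.1⟩ ⟨s, hs.1⟩ (by simpa using hrs) (by simpa using hr.2.1)
        (by simpa using hr.2.2) (by simpa using hs.2.1) (by simpa using hs.2.2)
  by_cases hij : i = j
  · subst hij
    simp [adjB]
  · rw [adjB, Bool.and_eq_true, Bool.or_eq_true, h1 hij, h2 hij, h3, h3]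
    simp [bracketGraph, hij]

lemma hasTwoNeighbors_of_derivedCount (hχ : Represents χ w) (hw : General w) {m : Fin 7}
    (hm : derivedCount w m = 2) : hasTwoNeighbors χ m = true := by
  obtain ⟨⟨a, ha⟩, ⟨b, hb⟩, ⟨c, hc⟩, hbc, hab, hac⟩ := exists_two_neighbors hm (by
    rw [Fintype.card_subtype_compl, Fintype.card_fin, Fintype.card_subtype_eq]; norm_num)
  have hall : ∀ x : Fin 7, x ∈ vertices := by decide
  simp only [hasTwoNeighbors, List.any_eq_true, Bool.and_eq_true]
  refine ⟨a, hall a, by simpa using ha, b, hall b, by simpa using hb, (adjB_iff hχ hw ha hb).2 hab,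
    c, hall c, by simpa using hc, by simpa using hbc, (adjB_iff hχ hw ha hc).2 hac⟩

lemma reachable_of_isChain (hχ : Represents χ w) (hw : General w) {m : Fin 7} (l : List (Fin 7))
    {a : Fin 7} (ha : a ≠ m) (hl : ∀ x ∈ l, x ≠ m)
    (hch : (a :: l).IsChain fun a b => adjB χ m a b = true) {x : Fin 7} (hx : x ≠ m)
    (hxl : x ∈ a :: l) :
    (bracketGraph fun x : {x : Fin 7 // x ≠ m} => w x).Reachable ⟨a, ha⟩ ⟨x, hx⟩ := by
  induction l generalizing a with
  | nil =>
    simp only [List.mem_singleton] at hxl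
    subst hxl
    rfl
  | cons b l ih =>
    rcases List.mem_cons.1 hxl with rfl | hxl
    · rfl
    · rw [List.isChain_cons_cons] at hch
      have hb : b ≠ m := hl b (by simp)
      exact ((adjB_iff hχ hw ha hb).1 hch.1).reachable.trans
        (ih hb (fun y hy => hl y (by simp [hy])) hch.2 hxl)

lemma derivedCount_of_hasHexagon (hχ : Represents χ w) (hw : General w)
    (h : hasHexagon χ = true) : ∃ m, m ≠ 6 ∧ derivedCount w m = 1 := by
  simp only [hasHexagon, List.any_eq_true] at h
  obtain ⟨⟨m, l⟩, hml, k, hk, hch⟩ := h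
  rw [chainB_iff] at hch
  have hmem : ∀ y ∈ [((0 : Fin 7), ([1, 2, 3, 4, 5] : List (Fin 7))), (1, [2, 3, 4, 5, 0]),
      (2, [3, 4, 5, 0, 1]), (3, [4, 5, 0, 1, 2]), (4, [5, 0, 1, 2, 3]), (5, [0, 1, 2, 3, 4])],
      y.1 ≠ 6 ∧ (∀ x ∈ y.2, x ≠ y.1) ∧ ∀ x, x ≠ y.1 → x = 6 ∨ x ∈ y.2 := by decide
  obtain ⟨hm, hl, hall⟩ := hmem _ hml
  refine ⟨m, hm, ?_⟩
  rw [derivedCount, Nat.card_eq_one_iff_unique]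
  have hr : ∀ x : {x : Fin 7 // x ≠ m},
      (bracketGraph fun x : {x : Fin 7 // x ≠ m} => w x).Reachable ⟨6, hm.symm⟩ x := fun x =>
    reachable_of_isChain hχ hw _ hm.symm (fun y hy => hl y (List.mem_rotate.1 hy)) hch x.2 (by
      rcases hall x x.2 with h | h
      · simp [h]
      · simp [h])
  refine ⟨⟨fun C D => ?_⟩, ⟨SimpleGraph.connectedComponentMk _ ⟨6, hm.symm⟩⟩⟩
  induction C using SimpleGraph.ConnectedComponent.ind with | _ x
  induction D using SimpleGraph.ConnectedComponent.ind with | _ y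
  exact SimpleGraph.ConnectedComponent.sound ((hr x).symm.trans (hr y))

lemma normalSigns_of_normalSignsB (hχ : Represents χ w) (hw : General w) {τ : Fin 7 → Fin 7}
    (hτ : Function.Injective τ) (h : normalSignsB χ τ = true) : NormalSigns (w ∘ τ) := by
  have hg : ∀ i j k, i ≠ j → j ≠ k → i ≠ k → bracket ((w ∘ τ) i) ((w ∘ τ) j) ((w ∘ τ) k) ≠ 0 :=
    hw.comp hτ
  have hs : ∀ i j k, i ≠ j → j ≠ k → i ≠ k → (χ (τ i) (τ j) (τ k) = true ↔
      0 < bracket ((w ∘ τ) i) ((w ∘ τ) j) ((w ∘ τ) k)) := fun i j k h1 h2 h3 =>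
    hχ _ _ _ (hτ.ne h1) (hτ.ne h2) (hτ.ne h3)
  have key : ∀ i j k i' j' k' a b c a' b' c', (i ≠ j ∧ j ≠ k ∧ i ≠ k) ∧
      (i' ≠ j' ∧ j' ≠ k' ∧ i' ≠ k') ∧ (a ≠ b ∧ b ≠ c ∧ a ≠ c) ∧ (a' ≠ b' ∧ b' ≠ c' ∧ a' ≠ c') →
      (posB (χ (τ i) (τ j) (τ k)) (χ (τ i') (τ j') (τ k')) (χ (τ a) (τ b) (τ c))
        (χ (τ a') (τ b') (τ c')) = true ↔
      0 < bracket ((w ∘ τ) i) ((w ∘ τ) j) ((w ∘ τ) k) *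
        bracket ((w ∘ τ) i') ((w ∘ τ) j') ((w ∘ τ) k') *
        (bracket ((w ∘ τ) a) ((w ∘ τ) b) ((w ∘ τ) c) *
        bracket ((w ∘ τ) a') ((w ∘ τ) b') ((w ∘ τ) c'))) ∧
      (posB (χ (τ i) (τ j) (τ k)) (χ (τ i') (τ j') (τ k')) (χ (τ a) (τ b) (τ c))
        (χ (τ a') (τ b') (τ c')) = false ↔
      bracket ((w ∘ τ) i) ((w ∘ τ) j) ((w ∘ τ) k) *
        bracket ((w ∘ τ) i') ((w ∘ τ) j') ((w ∘ τ) k') *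
        (bracket ((w ∘ τ) a) ((w ∘ τ) b) ((w ∘ τ) c) *
        bracket ((w ∘ τ) a') ((w ∘ τ) b') ((w ∘ τ) c')) < 0) := by
    rintro i j k i' j' k' a b c a' b' c' ⟨⟨p1, p2, p3⟩, ⟨q1, q2, q3⟩, ⟨r1, r2, r3⟩, s1, s2, s3⟩
    have n1 := hg i j k p1 p2 p3
    have n2 := hg i' j' k' q1 q2 q3
    have n3 := hg a b c r1 r2 r3
    have n4 := hg a' b' c' s1 s2 s3
    have e := posB_eq_true_iff n1 n2 n3 n4 (hs i j k p1 p2 p3) (hs i' j' k' q1 q2 q3)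
      (hs a b c r1 r2 r3) (hs a' b' c' s1 s2 s3)
    refine ⟨e, ?_⟩
    rw [← Bool.not_eq_true, e, not_lt]
    exact ⟨fun h => lt_of_le_of_ne h (mul_ne_zero (mul_ne_zero n1 n2) (mul_ne_zero n3 n4)), le_of_lt⟩
  simp only [normalSignsB, List.all_cons, List.all_nil, Bool.and_true, Bool.and_eq_true,
    Bool.not_eq_true'] at h
  obtain ⟨⟨⟨⟨⟨a1, a2⟩, b1, b2⟩, c1, c2⟩, ⟨d1, d2⟩, d3, d4⟩, ⟨e1, e2⟩, e3, e4⟩ := h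
  refine ⟨?_, ?_, ?_, ?_, ?_⟩
  · rintro i (rfl | rfl)
    · exact (key _ _ _ _ _ _ _ _ _ _ _ _ (by decide)).2.1 a1
    · exact (key _ _ _ _ _ _ _ _ _ _ _ _ (by decide)).2.1 a2
  · rintro i (rfl | rfl)
    · exact (key _ _ _ _ _ _ _ _ _ _ _ _ (by decide)).2.1 b1
    · exact (key _ _ _ _ _ _ _ _ _ _ _ _ (by decide)).2.1 b2
  · rintro i (rfl | rfl)
    · exact (key _ _ _ _ _ _ _ _ _ _ _ _ (by decide)).2.1 c1
    · exact (key _ _ _ _ _ _ _ _ _ _ _ _ (by decide)).2.1 c2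
  · rintro j k (rfl | rfl) (rfl | rfl)
    · exact (key _ _ _ _ _ _ _ _ _ _ _ _ (by decide)).1.1 d1
    · exact (key _ _ _ _ _ _ _ _ _ _ _ _ (by decide)).1.1 d2
    · exact (key _ _ _ _ _ _ _ _ _ _ _ _ (by decide)).1.1 d3
    · exact (key _ _ _ _ _ _ _ _ _ _ _ _ (by decide)).1.1 d4
  · rintro j k (rfl | rfl) (rfl | rfl)
    · exact (key _ _ _ _ _ _ _ _ _ _ _ _ (by decide)).2.1 e1
    · exact (key _ _ _ _ _ _ _ _ _ _ _ _ (by decide)).2.1 e2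
    · exact (key _ _ _ _ _ _ _ _ _ _ _ _ (by decide)).2.1 e3
    · exact (key _ _ _ _ _ _ _ _ _ _ _ _ (by decide)).2.1 e4

end

/-- Around a vertex `x` of a convex hexagon, the side of the lines to the other vertices on which a
point `p` lies changes at most once. -/
lemma changesOnce_bracket {x y₁ y₂ y₃ y₄ y₅ p : Fin 3 → ℝ}
    (h12 : 0 < bracket x y₁ y₂) (h13 : 0 < bracket x y₁ y₃) (h14 : 0 < bracket x y₁ y₄)
    (h15 : 0 < bracket x y₁ y₅) (h23 : 0 < bracket x y₂ y₃) (h24 : 0 < bracket x y₂ y₄)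
    (h25 : 0 < bracket x y₂ y₅) (h34 : 0 < bracket x y₃ y₄) (h35 : 0 < bracket x y₃ y₅)
    (h45 : 0 < bracket x y₄ y₅) :
    changesOnce (decide (0 < bracket x y₁ p)) (decide (0 < bracket x y₂ p))
      (decide (0 < bracket x y₃ p)) (decide (0 < bracket x y₄ p))
      (decide (0 < bracket x y₅ p)) = true := by
  have key : ∀ {a b c : Fin 3 → ℝ}, 0 < bracket x a b → 0 < bracket x a c → 0 < bracket x b c →
      decide (0 < bracket x a p) = decide (0 < bracket x c p) →
      decide (0 < bracket x b p) = decide (0 < bracket x a p) := by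
    intro a b c hab hac hbc h
    rw [decide_eq_decide] at h ⊢
    have hP := bracket_plucker x a b c p
    constructor
    · intro hb
      by_contra ha
      have hc := mt h.2 ha
      have := mul_pos hac hb
      nlinarith
    · intro ha
      have hc := h.1 ha
      have := mul_pos hab hc
      have := mul_pos ha hbc
      exact pos_of_mul_pos_right (by linarith : 0 < bracket x a c * bracket x b p) hac.le
  have t1 := key h12 h13 h23
  have t2 := key h12 h14 h24
  have t3 := key h12 h15 h25
  have t4 := key h13 h14 h34
  have t5 := key h13 h15 h35
  have t6 := key h14 h15 h45
  have t7 := key h23 h24 h34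
  have t8 := key h23 h25 h35
  have t9 := key h24 h25 h45
  have t10 := key h34 h35 h45
  revert t1 t2 t3 t4 t5 t6 t7 t8 t9 t10
  generalize decide (0 < bracket x y₁ p) = a
  generalize decide (0 < bracket x y₂ p) = b
  generalize decide (0 < bracket x y₃ p) = c
  generalize decide (0 < bracket x y₄ p) = d
  generalize decide (0 < bracket x y₅ p) = e
  cases a <;> cases b <;> cases c <;> cases d <;> cases e <;> simp [changesOnce]

/-- A hexagon and a point such that no other sextuple is a hexagon and all the others have two
components satisfy the normal sign conditions in a suitable order. -/
lemma exists_normalSigns {w : Fin 7 → Fin 3 → ℝ} (hw : General w)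
    (hex : ∀ i j k, i < j → j < k → k < 6 → 0 < bracket (w i) (w j) (w k))
    (hder : ∀ m, m ≠ 6 → derivedCount w m = 2) :
    ∃ τ : Equiv.Perm (Fin 7), NormalSigns (w ∘ τ) := by
  let s : Fin 7 → Fin 7 → Bool := fun i j => decide (0 < bracket (w i) (w j) (w 6))
  have hs : ∀ i j, i < j → j < 6 → (!s i j) = s j i := by
    intro i j h1 h2
    have hne := hw i j 6 h1.ne h2.ne (h1.trans h2).ne
    simp only [s]
    rw [bracket_swap_left (w i) (w j), ← decide_not, decide_eq_decide, not_lt, neg_pos]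
    exact ⟨fun h => lt_of_le_of_ne h hne, le_of_lt⟩
  have hrot : ∀ i j k, i < j → j < k → k < 6 → 0 < bracket (w j) (w k) (w i) :=
    fun i j k h1 h2 h3 => by rw [bracket_rotate]; exact hex i j k h1 h2 h3
  have hrot' : ∀ i j k, i < j → j < k → k < 6 → 0 < bracket (w k) (w i) (w j) :=
    fun i j k h1 h2 h3 => by rw [← bracket_rotate]; exact hex i j k h1 h2 h3
  obtain ⟨T, hT, hsearch⟩ : ∃ T : List (List Bool), (∀ i j : Fin 7, i ≠ j → i ≠ 6 → j ≠ 6 →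
      (T.getD i.1 []).getD j.1 false = s i j) ∧ searchB (hexagonSigns T) = true := by
    refine exists_table_searchB hs ?_ ?_ ?_ ?_ ?_ ?_ <;> apply changesOnce_bracket <;> first
      | exact hex _ _ _ (by decide) (by decide) (by decide)
      | exact hrot _ _ _ (by decide) (by decide) (by decide)
      | exact hrot' _ _ _ (by decide) (by decide) (by decide)
  have hbeq : ∀ x : Fin 7, x ≠ 6 → x.1.beq 6 = false := by decide
  have hχ : Represents (hexagonSigns T) w := by
    intro i j k hij hjk hik
    by_cases hk : k = 6
    · subst hk
      rw [show hexagonSigns T i j 6 = (T.getD i.1 []).getD j.1 false from rfl, hT i j hij hik hjk]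
      exact decide_eq_true_iff
    by_cases hj : j = 6
    · subst hj
      have hk' := hbeq k hk
      rw [show hexagonSigns T i 6 k = (T.getD k.1 []).getD i.1 false by
        simp only [hexagonSigns, hk']; rfl, hT k i hik.symm hk hij, ← bracket_rotate (w i),
        ← bracket_rotate (w 6)]
      exact decide_eq_true_iff
    by_cases hi : i = 6
    · subst hi
      have hk' := hbeq k hk
      have hj' := hbeq j hj
      rw [show hexagonSigns T 6 j k = (T.getD j.1 []).getD k.1 false by
        simp only [hexagonSigns, hk', hj']; rfl, hT j k hjk hj hk, ← bracket_rotate (w 6)]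
      exact decide_eq_true_iff
    have hi6 : i < 6 := lt_of_le_of_ne (Fin.le_last i) hi
    have hj6 : j < 6 := lt_of_le_of_ne (Fin.le_last j) hj
    have hk6 : k < 6 := lt_of_le_of_ne (Fin.le_last k) hk
    have hval : hexagonSigns T i j k = true ↔
        (i < j ∧ (j < k ∨ k < i)) ∨ (j < i ∧ j < k ∧ k < i) := by
      have hk' := hbeq k hk
      have hj' := hbeq j hj
      have hi' := hbeq i hi
      simp only [hexagonSigns, hk', hj', hi', cond_false]
      rcases lt_or_gt_of_ne hij with h | h
      · have : i.1.blt j.1 = true := Nat.blt_eq.mpr h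
        simp [this, Nat.blt_eq, h, h.not_gt]
      · have : i.1.blt j.1 = false := by
          rw [← Bool.not_eq_true, Nat.blt_eq]; exact h.not_gt
        simp [this, Nat.blt_eq, h, h.not_gt]
    rw [hval]
    rcases lt_or_gt_of_ne hij with h1 | h1 <;> rcases lt_or_gt_of_ne hjk with h2 | h2 <;>
      rcases lt_or_gt_of_ne hik with h3 | h3
    · simp [h1, h2, hex i j k h1 h2 hk6]
    · exact absurd (h1.trans h2) h3.not_gt
    · have := hex i k j h3 h2 hj6
      rw [bracket_swap_right] at this
      simp [h1, h2.not_gt, h3.not_gt, h1.not_gt, (neg_pos.1 this).not_gt]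
    · have := hex k i j h3 h1 hj6
      rw [← bracket_rotate] at this
      simp [h1, h3, this]
    · have := hex j i k h1 h3 hk6
      rw [bracket_swap_left] at this
      simp [h1.not_gt, h3.not_gt, (neg_pos.1 this).not_gt]
    · have := hex j k i h2 h3 hi6
      rw [bracket_rotate] at this
      simp [h1, h2, h3, this]
    · exact absurd (h2.trans h1) h3.not_gt
    · have := hex k j i h2 h1 hi6
      rw [← bracket_rotate, bracket_swap_left] at this
      simp [h1.not_gt, h2.not_gt, (neg_pos.1 this).not_gt]
  simp only [searchB, Bool.or_eq_true, Bool.not_eq_true', List.any_eq_true] at hsearch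
  rcases hsearch with ⟨τ, hτ, h⟩ | h | h
  · have hinj := injective_of_mem_labellings hτ
    exact ⟨Equiv.ofBijective τ (Finite.injective_iff_bijective.1 hinj),
      normalSigns_of_normalSignsB hχ hw hinj h⟩
  · obtain ⟨m, hm, h1⟩ := derivedCount_of_hasHexagon hχ hw h
    rw [hder m hm] at h1
    omega
  · rw [← Bool.not_eq_true, List.all_eq_true] at h
    refine absurd (fun m hm => hasTwoNeighbors_of_derivedCount hχ hw (hder m ?_)) h
    rintro rfl
    revert hm
    decide

/-! ### Deforming to the normal form -/

lemma ncard_derivedCount (v : {v : Fin 7 → Fin 3 → ℝ // General v}) {σ₁ σ₂ σ₃ σ₆ : ℕ} :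
    toConfig v ∈ LC7 (σ₁, σ₂, σ₃, σ₆) ↔ {m | derivedCount v.1 m = 1}.ncard = σ₁ ∧
      {m | derivedCount v.1 m = 2}.ncard = σ₂ ∧ {m | derivedCount v.1 m = 3}.ncard = σ₃ ∧
      {m | derivedCount v.1 m = 6}.ncard = σ₆ := by
  simp only [← labelCount_toConfig]
  constructor
  · rintro ⟨-, h⟩
    simpa [derivativeCode] using h
  · intro h
    exact ⟨isSimple_toConfig v, by simpa [derivativeCode] using h⟩

/-- Every typical configuration with derivative code `(1, 6, 0, 0)` can be deformed to a normal
form. -/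
lemma exists_qEquivalent_expForm (v : {v : Fin 7 → Fin 3 → ℝ // General v})
    (hv : toConfig v ∈ QC7 (1, 6, 0, 0)) :
    ∃ k ∈ logCone, total k ≠ 0 ∧ QEquivalent v.1 (expForm k) := by
  have hT : Typical v.1 := (isTypical_toConfig_iff v).1 hv.2
  obtain ⟨h1, h2, -, -⟩ := (ncard_derivedCount v).1 hv.1
  obtain ⟨p, hp⟩ := Set.ncard_eq_one.1 h1
  have hp1 : derivedCount v.1 p = 1 := by
    have : p ∈ {m | derivedCount v.1 m = 1} := by rw [hp]; rfl
    exact this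
  have hp2 : ∀ m, m ≠ p → derivedCount v.1 m = 2 := by
    have hsub : {m | derivedCount v.1 m = 2} ⊆ {p}ᶜ := by
      rintro m hm rfl
      have hm' : derivedCount v.1 m = 2 := hm
      omega
    have heq := Set.eq_of_subset_of_ncard_le hsub (by
      rw [h2, Set.ncard_compl, Set.ncard_singleton]; simp)
    intro m hm
    have : m ∈ {m | derivedCount v.1 m = 2} := by rw [heq]; exact hm
    exact this
  obtain ⟨τ, ε, hε, hτ, hex⟩ := exists_hexagon hp1
  have hw : General fun i => ε i • v.1 (τ i) :=
    v.2.perm_smul τ ε hε fun i => rfl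
  obtain ⟨τ', hS⟩ := exists_normalSigns hw hex fun m hm => by
    rw [derivedCount_perm_smul v.2 hw τ ε fun i => rfl]
    exact hp2 _ fun h => hm (τ.injective (h.trans hτ.symm))
  have hE : QEquivalent v.1 ((fun i => ε i • v.1 (τ i)) ∘ τ') :=
    hT.qEquivalent_perm_smul (τ'.trans τ) (ε ∘ τ') (fun i => hε _) fun i => rfl
  obtain ⟨k, hk, hk', h⟩ := hS.exists_normalForm hE.typical
  exact ⟨k, hk, hk', hE.trans h⟩

/-! ### An example -/

/-- Integral vectors representing the normal form with parameters `1/8, 16, 1/2, 2, 1/2, 2`. -/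
def exampleInt : Fin 7 → Fin 3 → ℤ :=
  ![![0, 8, -1], ![0, 1, -16], ![-1, 0, 2], ![-2, 0, 1], ![2, -1, 0], ![1, -2, 0], ![1, 1, 1]]

/-- The real vectors with the coordinates `exampleInt`. -/
def exampleFamily (i : Fin 7) (j : Fin 3) : ℝ := exampleInt i j

/-- The bracket signs of `exampleFamily`, computed in the integers. -/
def exampleSigns (i j k : Fin 7) : Bool :=
  decide (0 < exampleInt i 0 * (exampleInt j 1 * exampleInt k 2 - exampleInt j 2 * exampleInt k 1)
    - exampleInt i 1 * (exampleInt j 0 * exampleInt k 2 - exampleInt j 2 * exampleInt k 0)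
    + exampleInt i 2 * (exampleInt j 0 * exampleInt k 1 - exampleInt j 1 * exampleInt k 0))

lemma represents_exampleSigns : Represents exampleSigns exampleFamily := by
  intro i j k _ _ _
  rw [exampleSigns, decide_eq_true_iff, ← Int.cast_pos (R := ℝ)]
  push_cast
  rfl

lemma typical_exampleFamily : Typical exampleFamily := by
  have h : Typical (normalForm (1 / 8) 16 (1 / 2) 2 (1 / 2) 2) := by
    apply typical_normalForm <;> norm_num
  refine (h.qEquivalent_perm_smul (Equiv.refl _) ![8, 1, 2, 1, 2, 1, 1] ?_ ?_).typical
  · intro i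
    fin_cases i <;> simp
  · intro i
    ext j
    fin_cases i <;> fin_cases j <;> norm_num [exampleFamily, exampleInt, normalForm]

/-- The adjacency graph without the point `m` has two components if it is covered by two paths that
no edge connects. -/
lemma derivedCount_eq_two {χ : Fin 7 → Fin 7 → Fin 7 → Bool} {w : Fin 7 → Fin 3 → ℝ}
    (hχ : Represents χ w) (hw : General w) {m : Fin 7} (a b : Fin 7) (l l' : List (Fin 7))
    (hl : ∀ x ∈ a :: l, x ≠ m) (hl' : ∀ x ∈ b :: l', x ≠ m)
    (hall : ∀ x, x ≠ m → x ∈ a :: l ∨ x ∈ b :: l') (hch : chainB (adjB χ m) (a :: l) = true)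
    (hch' : chainB (adjB χ m) (b :: l') = true) (hb : b ∉ a :: l)
    (hsep : ∀ x ∈ a :: l, ∀ y, y ≠ m → y ∉ a :: l → adjB χ m x y = false) :
    derivedCount w m = 2 := by
  have ha := hl a (by simp)
  have hb' := hl' b (by simp)
  rw [chainB_iff] at hch hch'
  rw [derivedCount, Nat.card_eq_two_iff]
  refine ⟨SimpleGraph.connectedComponentMk _ ⟨a, ha⟩, SimpleGraph.connectedComponentMk _ ⟨b, hb'⟩,
    fun h => ?_, Set.eq_univ_of_forall fun C => ?_⟩
  · obtain ⟨p⟩ := SimpleGraph.ConnectedComponent.exact h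
    obtain ⟨d, -, h1, h2⟩ := p.exists_boundary_dart {x | x.1 ∈ a :: l} (by simp) hb
    have := hsep _ h1 _ d.snd.2 h2
    rw [← Bool.not_eq_true, adjB_iff hχ hw d.fst.2 d.snd.2] at this
    exact this d.adj
  · induction C using SimpleGraph.ConnectedComponent.ind with | _ x
    rcases hall x x.2 with h | h
    · exact .inl (SimpleGraph.ConnectedComponent.sound (reachable_of_isChain hχ hw l ha
        (fun y hy => hl y (by simp [hy])) hch x.2 h).symm)
    · exact .inr (SimpleGraph.ConnectedComponent.sound (reachable_of_isChain hχ hw l' hb'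
        (fun y hy => hl' y (by simp [hy])) hch' x.2 h).symm)

lemma derivedCount_exampleFamily (m : Fin 7) :
    derivedCount exampleFamily m = if m = 6 then 1 else 2 := by
  have hχ := represents_exampleSigns
  have hw := typical_exampleFamily.general
  fin_cases m
  · exact derivedCount_eq_two hχ hw 1 4 [2, 3] [5, 6] (by decide) (by decide) (by decide)
      (by decide +kernel) (by decide +kernel) (by decide) (by decide +kernel)
  · exact derivedCount_eq_two hχ hw 0 3 [5, 4] [2, 6] (by decide) (by decide) (by decide)
      (by decide +kernel) (by decide +kernel) (by decide) (by decide +kernel)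
  · exact derivedCount_eq_two hχ hw 0 3 [5, 4] [1, 6] (by decide) (by decide) (by decide)
      (by decide +kernel) (by decide +kernel) (by decide) (by decide +kernel)
  · exact derivedCount_eq_two hχ hw 0 2 [5, 4] [1, 6] (by decide) (by decide) (by decide)
      (by decide +kernel) (by decide +kernel) (by decide) (by decide +kernel)
  · exact derivedCount_eq_two hχ hw 5 1 [0, 6] [2, 3] (by decide) (by decide) (by decide)
      (by decide +kernel) (by decide +kernel) (by decide) (by decide +kernel)
  · exact derivedCount_eq_two hχ hw 4 1 [0, 6] [2, 3] (by decide) (by decide) (by decide)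
      (by decide +kernel) (by decide +kernel) (by decide) (by decide +kernel)
  · have hr : ∀ x (hx : x ≠ 6), (bracketGraph fun x : {x : Fin 7 // x ≠ 6} =>
        exampleFamily x).Reachable ⟨0, by decide⟩ ⟨x, hx⟩ := fun x hx =>
      reachable_of_isChain hχ hw [3, 2, 1, 4, 5] (by decide) (by decide)
        ((chainB_iff _ _).1 (by decide +kernel)) hx (by revert x; decide)
    change derivedCount exampleFamily 6 = 1
    rw [derivedCount, Nat.card_eq_one_iff_unique]
    refine ⟨⟨fun C D => ?_⟩, ⟨SimpleGraph.connectedComponentMk _ ⟨0, by decide⟩⟩⟩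
    induction C using SimpleGraph.ConnectedComponent.ind with | _ x
    induction D using SimpleGraph.ConnectedComponent.ind with | _ y
    exact SimpleGraph.ConnectedComponent.sound ((hr x x.2).symm.trans (hr y y.2))

lemma exampleFamily_mem :
    toConfig ⟨exampleFamily, typical_exampleFamily.general⟩ ∈ QC7 (1, 6, 0, 0) := by
  refine ⟨?_, (isTypical_toConfig_iff _).2 typical_exampleFamily⟩
  simp only [ncard_derivedCount, derivedCount_exampleFamily, Set.ncard_eq_toFinset_card']
  decide

/-- Any two typical configurations with derivative code `(1, 6, 0, 0)` are joined by a path of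
typical configurations. -/
lemma joinedIn_of_mem {P P' : Configuration 7} (hP : P ∈ QC7 (1, 6, 0, 0))
    (hP' : P' ∈ QC7 (1, 6, 0, 0)) : JoinedIn (typicalConfigurations 7) P P' := by
  obtain ⟨v, rfl⟩ := exists_toConfig_eq hP.1.1
  obtain ⟨v', rfl⟩ := exists_toConfig_eq hP'.1.1
  obtain ⟨k, hk, hk', h⟩ := exists_qEquivalent_expForm v hP
  obtain ⟨l, hl, hl', h'⟩ := exists_qEquivalent_expForm v' hP'
  exact ((h.trans (qEquivalent_expForm hk hl hk' hl')).trans h'.symm).2.2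

end PlaneConfig

theorem proposition5p1 :
    IsConnected (PlaneConfig.QC7 (1, 6, 0, 0)) ∧
      ∃! C : Set (PlaneConfig.Configuration 7),
        PlaneConfig.IsQDeformationClass C ∧ C ⊆ PlaneConfig.LC7 (1, 6, 0, 0) := by
  have hmem := PlaneConfig.exampleFamily_mem
  generalize PlaneConfig.toConfig
    ⟨PlaneConfig.exampleFamily, PlaneConfig.typical_exampleFamily.general⟩ = P at hmem
  have hclass : ∀ P' ∈ PlaneConfig.QC7 (1, 6, 0, 0), PlaneConfig.QC7 (1, 6, 0, 0) =
      pathComponentIn (PlaneConfig.typicalConfigurations 7) P' := fun P' hP' =>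
    Set.Subset.antisymm (fun _ h => PlaneConfig.joinedIn_of_mem hP' h)
      fun _ h => ⟨PlaneConfig.LC7_of_joinedIn h hP'.1, JoinedIn.target_mem h⟩
  refine ⟨?_, PlaneConfig.QC7 (1, 6, 0, 0), ⟨⟨P, hmem.2, hclass P hmem⟩, Set.inter_subset_left⟩, ?_⟩
  · rw [hclass P hmem]
    exact (isPathConnected_pathComponentIn hmem.2).isConnected
  · rintro C ⟨⟨P', hP', rfl⟩, hC⟩
    exact (hclass P' ⟨hC (mem_pathComponentIn_self hP'), hP'⟩).symm
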